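/- A code $C\subseteq\Sigma^n$ is called $(\alpha,\ell,L)$-list recoverable if for all $S_1,\dots,S_n\subseteq\Sigma$ with $|S_1|=\cdots=|S_n|=\ell$ there are at most $L$ codewords $x\in C$ with $|\{i : x_i\notin S_i\}|\le \alpha n$. Theorem. For all $\alpha\in(0,1)$, $\varepsilon\in(0,1)$ and every integer $d\ge 1$ there exist a real $\delta>0$, an integer $n_0\ge 1$ and a computable function $f:\mathbb{Z}^+\to\mathbb{Z}^+$ (all depending on $\alpha,\varepsilon,d$), where $n_0=n_0(\alpha,\varepsilon,d)$ can be chosen such that, for fixed $\alpha,\varepsilon$, $n_0=O_{\alpha,\varepsilon}(d\log d)$ as $d\to\infty$, with the following property. For every integer $n\ge n_0$ and every prime $p\ge f(n)$, with probability at least $1-\varepsilon$ a uniformly random $d$-dimensional linear subspace $C\subseteq\mathbb{F}_p^n$ is $\left(\alpha,\ell,\frac{1+\varepsilon}{1-\alpha}\,\ell\right)$-list recoverable simultaneously for all positive integers $\ell\le 2^{\delta n/\log n}$, where $\log$ is the natural logarithm. -/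

import Mathlib

/-- A code `C ⊆ Σⁿ` is `(α, ℓ, L)`-list recoverable if for all `S₁, …, Sₙ ⊆ Σ` with
`|S₁| = ⋯ = |Sₙ| = ℓ` there are at most `L` codewords `x ∈ C` with `|{i : xᵢ ∉ Sᵢ}| ≤ α n`. -/
def IsListRecoverable {A : Type*} {n : ℕ} (C : Set (Fin n → A)) (α : ℝ) (ℓ : ℕ) (L : ℝ) : Prop :=
  ∀ S : Fin n → Finset A, (∀ i, (S i).card = ℓ) →
    {x ∈ C | ({i | x i ∉ S i}.ncard : ℝ) ≤ α * n}.Finite ∧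
    ({x ∈ C | ({i | x i ∉ S i}.ncard : ℝ) ≤ α * n}.ncard : ℝ) ≤ L

/-- The set of all `d`-dimensional linear codes of length `n` over `𝔽_p`. -/
def linearCodes (p n d : ℕ) [Fact p.Prime] : Set (Submodule (ZMod p) (Fin n → ZMod p)) :=
  {C | Module.finrank (ZMod p) C = d}

/-- The probability that a uniformly random `d`-dimensional linear code `C ⊆ 𝔽_pⁿ` satisfies `P`:
the proportion of such codes satisfying `P`, among the finitely many `d`-dimensional ones
(and `0` if there is no `d`-dimensional code). -/
noncomputable def randomCodeProb (p n d : ℕ) [Fact p.Prime]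
    (P : Submodule (ZMod p) (Fin n → ZMod p) → Prop) : ℝ :=
  ({C ∈ linearCodes p n d | P C}.ncard : ℝ) / ((linearCodes p n d).ncard : ℝ)

/-!
# List recoverability of random linear codes over large prime fields

A `d`-dimensional code of length `n` consists of the words `(⟨φ 0, v⟩, …, ⟨φ (n - 1), v⟩)` for a
family `φ` of `n` linear forms on `F ^ d`. If its list recoverability fails, averaging over the
coordinates gives a set `X` of at most `4 ℓ / (1 - α)` vectors which the forms
collapse on average: `∑ i, (|X| - |φ i (X)|) ≥ η n |X|`, where `η = (1 - α) ε / (1 + ε)`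
(`le_collapse_of_agree`). This is shown to be impossible for generic `φ`.

*Expansion.* A subset `Y` of `X` maximising the collapse relative to `|Y| log |Y|` is an expander:
every `S ⊆ Y` shares fibres with `Y \ S` under at least `λ log (|Y| / |S|)` of the forms, where
`λ = η n / log |X|` (`exists_expanding_subset`). If coordinates are revealed in random order and
points of `Y` in a common fibre are merged, each revealed coordinate therefore decreases the expected
number `G` of classes by at least `λ G log G / (2 n)`, so that `log G` decays exponentially
(`log_avgClasses_le`). As soon as `λ > 4 d log (2 d log |X|)`, a random partition of the coordinates
into `d` parts has the property that each part alone connects `Y` with positive probability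
(`exists_partition_of_expanding`).

*Algebra.* Choose a spanning tree of `Y` within each of the `d` parts. The edges of these trees give
a square system of linear equations `⟨φ i, v y - v y'⟩ = 0` for the differences of the points of `Y`.
If the forms of the `j`-th part are specialised to the `j`-th coordinate, the only solution is zero,
since the `j`-th tree is spanning; so the determinant is a nonzero polynomial in `φ`
(`treeDet_ne_zero`). The points of `Y` being a nontrivial solution, the determinant vanishes at the
given `φ` (`det_treeMatrix_eq_zero`). There are boundedly many systems in terms of `n`, hence by the
Schwartz–Zippel lemma almost all `φ` avoid the zeros of all these polynomials if `p` is large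
(`card_not_isTreeGeneric_le`).

*Parameters.* The condition on `λ` reads `4 d log |X| log (2 d log |X|) < η n`. It holds for `|X|`
bounded if `n` is at least a multiple of `d log d`, and for `|X| ≤ 2 ^ (δ n / log n)` if `δ` is a
small multiple of `1 / d` (`four_mul_log_mul_log_lt`).
-/

/-! ### Finite sets that are expanding with respect to a family of colourings -/

section Expansion

variable {ι V A : Type*} [Fintype ι] [DecidableEq A]

/-- The total number of points lost when `Y` is mapped to its images under the maps `a i`. -/
def collapse (a : ι → V → A) (Y : Finset V) : ℝ :=
  ∑ i, ((Y.card : ℝ) - ((Y.image (a i)).card : ℝ))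

lemma collapse_nonpos_of_card_le_one (a : ι → V → A) {S : Finset V} (hS : S.card ≤ 1) :
    collapse a S ≤ 0 := by
  refine Finset.sum_nonpos fun i _ => ?_
  rcases S.eq_empty_or_nonempty with rfl | h
  · simp
  · have : 1 ≤ (S.image (a i)).card := Finset.card_pos.2 (h.image _)
    have : S.card ≤ (S.image (a i)).card := hS.trans this
    have : (S.card : ℝ) ≤ (S.image (a i)).card := by exact_mod_cast this
    linarith

variable [DecidableEq V]

/-- The indices `i` for which some fibre of `a i` meets both `S` and `Y \ S`. -/
def cutIndices (a : ι → V → A) (Y S : Finset V) : Finset ι :=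
  Finset.univ.filter fun i => ∃ x ∈ S, ∃ y ∈ Y \ S, a i x = a i y

lemma collapse_le_of_subset (a : ι → V → A) {Y S : Finset V} (hS : S ⊆ Y) :
    collapse a Y ≤ collapse a S + collapse a (Y \ S) + S.card * (cutIndices a Y S).card := by
  classical
  have key : ∀ i, ((Y.card : ℝ) - ((Y.image (a i)).card : ℝ)) ≤
      ((S.card : ℝ) - ((S.image (a i)).card : ℝ)) +
      (((Y \ S).card : ℝ) - (((Y \ S).image (a i)).card : ℝ)) +
      (if i ∈ cutIndices a Y S then (S.card : ℝ) else 0) := by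
    intro i
    have h1 : (Y.image (a i)) = S.image (a i) ∪ (Y \ S).image (a i) := by
      rw [← Finset.image_union, Finset.union_sdiff_of_subset hS]
    have h2 := Finset.card_union_add_card_inter (S.image (a i)) ((Y \ S).image (a i))
    rw [← h1] at h2
    have h3 : (S.card : ℝ) + (Y \ S).card = Y.card := by
      have := Finset.card_sdiff_add_card_eq_card hS
      rw [← this]; push_cast; ring
    have h2' : ((Y.image (a i)).card : ℝ) + ((S.image (a i) ∩ (Y \ S).image (a i)).card : ℝ) =
      (S.image (a i)).card + ((Y \ S).image (a i)).card := by exact_mod_cast h2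
    split_ifs with h
    · have h4 : ((S.image (a i) ∩ (Y \ S).image (a i)).card : ℝ) ≤ S.card := by
        exact_mod_cast (Finset.card_le_card Finset.inter_subset_left).trans Finset.card_image_le
      linarith
    · have h4 : S.image (a i) ∩ (Y \ S).image (a i) = ∅ := by
        rw [Finset.eq_empty_iff_forall_notMem]
        intro z hz
        apply h
        simp only [Finset.mem_inter, Finset.mem_image] at hz
        obtain ⟨⟨x, hx, rfl⟩, y, hy, hxy⟩ := hz
        simp only [cutIndices, Finset.mem_filter, Finset.mem_univ, true_and]
        exact ⟨x, hx, y, hy, hxy.symm⟩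
      rw [h4] at h2'
      simp only [Finset.card_empty, Nat.cast_zero] at h2'
      linarith
  calc collapse a Y ≤ ∑ i, (((S.card : ℝ) - ((S.image (a i)).card : ℝ)) +
      (((Y \ S).card : ℝ) - (((Y \ S).image (a i)).card : ℝ)) +
      (if i ∈ cutIndices a Y S then (S.card : ℝ) else 0)) := Finset.sum_le_sum fun i _ => key i
    _ = _ := by
      rw [Finset.sum_add_distrib, Finset.sum_add_distrib, Finset.sum_ite_mem, Finset.univ_inter,
        Finset.sum_const, nsmul_eq_mul, collapse, collapse]
      ring

/-- A set that loses many points under the maps `a i` contains a subset `Y` all of whose subsets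
have a large boundary. Such a `Y` maximises `collapse a Y / (|Y| log |Y|)`; the boundary estimate
then has the shape of the edge-isoperimetric inequality of the hypercube. -/
theorem exists_expanding_subset (a : ι → V → A) (X : Finset V) (hX : 2 ≤ X.card) {lam : ℝ}
    (h : lam * (X.card * Real.log X.card) ≤ collapse a X) (hlam : 0 ≤ lam) :
    ∃ Y ⊆ X, 2 ≤ Y.card ∧ ∀ S ⊆ Y, S.Nonempty →
      lam * Real.log (Y.card / S.card) ≤ (cutIndices a Y S).card := by
  have hpos : ∀ {Y : Finset V}, 2 ≤ Y.card → 0 < (Y.card : ℝ) * Real.log Y.card := by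
    intro Y hY
    have : (2 : ℝ) ≤ Y.card := by exact_mod_cast hY
    exact mul_pos (by linarith) (Real.log_pos (by linarith))
  obtain ⟨Y, hY, hmax⟩ := Finset.exists_max_image (X.powerset.filter fun Y => 2 ≤ Y.card)
    (fun Y => collapse a Y / (Y.card * Real.log Y.card)) ⟨X, by simpa using hX⟩
  simp only [Finset.mem_filter, Finset.mem_powerset] at hY hmax
  obtain ⟨hYX, hY2⟩ := hY
  refine ⟨Y, hYX, hY2, fun S hS hSne => ?_⟩
  set μ := collapse a Y / (Y.card * Real.log Y.card) with hμ
  have hlamμ : lam ≤ μ := by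
    refine le_trans ?_ (hmax X ⟨subset_rfl, hX⟩)
    rw [le_div_iff₀ (hpos hX)]
    exact h
  have hμ0 : 0 ≤ μ := hlam.trans hlamμ
  have hYeq : collapse a Y = μ * (Y.card * Real.log Y.card) := by
    rw [hμ, div_mul_cancel₀ _ (hpos hY2).ne']
  have hsub : ∀ T ⊆ Y, collapse a T ≤ μ * (T.card * Real.log T.card) := by
    intro T hT
    by_cases hT2 : 2 ≤ T.card
    · have := hmax T ⟨hT.trans hYX, hT2⟩
      rwa [div_le_iff₀ (hpos hT2)] at this
    · refine (collapse_nonpos_of_card_le_one a (by omega)).trans ?_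
      exact mul_nonneg hμ0 (mul_nonneg (Nat.cast_nonneg _) (Real.log_natCast_nonneg _))
  have h1 := collapse_le_of_subset a hS
  have h2 := hsub S hS
  have h3 := hsub (Y \ S) Finset.sdiff_subset
  have hs : (0 : ℝ) < S.card := by exact_mod_cast hSne.card_pos
  have hSY : (S.card : ℝ) ≤ Y.card := by exact_mod_cast Finset.card_le_card hS
  have hcard : (Y.card : ℝ) = S.card + (Y \ S).card := by
    rw [← Finset.card_sdiff_add_card_eq_card hS]; push_cast; ring
  have hTlog : ((Y \ S).card : ℝ) * Real.log (Y \ S).card ≤ (Y \ S).card * Real.log Y.card := by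
    rcases (Nat.zero_le (Y \ S).card).eq_or_lt with h0 | h0
    · rw [← h0]; simp
    · have h0' : (0 : ℝ) < (Y \ S).card := by exact_mod_cast h0
      exact mul_le_mul_of_nonneg_left (Real.log_le_log h0' (by linarith)) h0'.le
  have h4 : μ * (S.card * Real.log (Y.card / S.card)) ≤ S.card * (cutIndices a Y S).card := by
    rw [Real.log_div (by linarith) hs.ne']
    have : μ * (S.card * (Real.log Y.card - Real.log S.card)) ≤ μ * (Y.card * Real.log Y.card) -
        μ * (S.card * Real.log S.card) -
        μ * ((Y \ S).card * Real.log (Y \ S).card) := by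
      rw [← mul_sub, ← mul_sub]
      refine mul_le_mul_of_nonneg_left ?_ hμ0
      have h5 : (Y.card : ℝ) * Real.log Y.card =
        S.card * Real.log Y.card + (Y \ S).card * Real.log Y.card := by
          rw [← add_mul, ← hcard]
      linarith
    linarith
  have h5 : (0 : ℝ) ≤ Real.log (Y.card / S.card) :=
    Real.log_nonneg (by rw [le_div_iff₀ hs]; linarith)
  calc lam * Real.log (Y.card / S.card) ≤ μ * Real.log (Y.card / S.card) :=
        mul_le_mul_of_nonneg_right hlamμ h5
    _ ≤ _ := by
      refine le_of_mul_le_mul_left ?_ hs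
      linarith

end Expansion

/-! ### Joins of random subfamilies of the kernels of the colourings -/

section Join

variable {ι V A : Type*}

/-- The equivalence relation generated by the relations `a i x = a i y` for `i ∈ J`. -/
def joinKer (a : ι → V → A) (J : Finset ι) : Setoid V :=
  ⨆ i ∈ J, Setoid.ker (a i)

/-- The number of classes of `joinKer a J`. -/
noncomputable def numClasses (a : ι → V → A) (J : Finset ι) : ℕ :=
  Nat.card (Quotient (joinKer a J))

lemma ker_le_joinKer (a : ι → V → A) {J : Finset ι} {i : ι} (hi : i ∈ J) :
    Setoid.ker (a i) ≤ joinKer a J :=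
  le_iSup₂_of_le i hi le_rfl

lemma joinKer_mono (a : ι → V → A) {J K : Finset ι} (h : J ⊆ K) : joinKer a J ≤ joinKer a K :=
  iSup₂_le fun _ hi => ker_le_joinKer a (h hi)

lemma two_mul_card_add_card_le_of_surjective {Q Q' : Type*} [Fintype Q] [Fintype Q'] {f : Q → Q'}
    (hf : Function.Surjective f) (T : Finset Q) (hT : ∀ t ∈ T, ∃ t', t' ≠ t ∧ f t' = f t) :
    2 * Fintype.card Q' + T.card ≤ 2 * Fintype.card Q := by
  classical
  have h1 : Fintype.card Q = ∑ q' : Q', (Finset.univ.filter fun q => f q = q').card := by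
    rw [← Finset.card_univ]
    exact Finset.card_eq_sum_card_fiberwise fun _ _ => Finset.mem_coe.2 (Finset.mem_univ _)
  have h2 : T.card = ∑ q' : Q', (T.filter fun q => f q = q').card :=
    Finset.card_eq_sum_card_fiberwise fun _ _ => Finset.mem_coe.2 (Finset.mem_univ _)
  have h3 : 2 * Fintype.card Q' = ∑ _q' : Q', 2 := by simp [mul_comm]
  rw [h1, h2, h3, Finset.mul_sum, ← Finset.sum_add_distrib]
  refine Finset.sum_le_sum fun q' _ => ?_
  have hle : (T.filter fun q => f q = q').card ≤ (Finset.univ.filter fun q => f q = q').card :=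
    Finset.card_le_card (Finset.filter_subset_filter _ (Finset.subset_univ _))
  obtain ⟨q, hq⟩ := hf q'
  have hpos : 0 < (Finset.univ.filter fun q => f q = q').card :=
    Finset.card_pos.2 ⟨q, by simpa using hq⟩
  rcases (T.filter fun q => f q = q').eq_empty_or_nonempty with h0 | ⟨t, ht⟩
  · rw [h0, Finset.card_empty]; omega
  · rw [Finset.mem_filter] at ht
    obtain ⟨t', hne, ht'⟩ := hT t ht.1
    have : 1 < (Finset.univ.filter fun q => f q = q').card :=
      Finset.one_lt_card.2 ⟨t, by simpa using ht.2, t', by simpa using ht'.trans ht.2, hne.symm⟩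
    omega

variable [Fintype V]

lemma numClasses_pos [Nonempty V] (a : ι → V → A) (J : Finset ι) : 0 < numClasses a J :=
  have : Nonempty (Quotient (joinKer a J)) := (‹Nonempty V›).map (Quotient.mk _)
  Nat.card_pos

lemma numClasses_le_card (a : ι → V → A) (J : Finset ι) : numClasses a J ≤ Fintype.card V := by
  rw [← Nat.card_eq_fintype_card]
  exact Nat.card_le_card_of_surjective (Quotient.mk (joinKer a J)) Quotient.mk_surjective

lemma joinKer_eq_top_of_numClasses_le_one {a : ι → V → A} {J : Finset ι}
    (h : numClasses a J ≤ 1) : joinKer a J = ⊤ := by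
  have hs : Subsingleton (Quotient (joinKer a J)) := Finite.card_le_one_iff_subsingleton.1 h
  refine Setoid.eq_top_iff.2 fun x y => ?_
  exact Quotient.exact (hs.elim (Quotient.mk (joinKer a J) x) (Quotient.mk (joinKer a J) y))

open Classical in
/-- The indices `i` for which some fibre of `a i` meets both `S` and its complement. -/
noncomputable def boundaryIndices [Fintype ι] (a : ι → V → A) (S : Finset V) : Finset ι :=
  Finset.univ.filter fun i => ∃ x ∈ S, ∃ y ∉ S, a i x = a i y

open Classical in
/-- The elements of a class, as a finset. -/
noncomputable def classFinset (r : Setoid V) (q : Quotient r) : Finset V :=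
  Finset.univ.filter fun x => Quotient.mk r x = q

lemma mem_classFinset {r : Setoid V} {q : Quotient r} {x : V} :
    x ∈ classFinset r q ↔ Quotient.mk r x = q := by
  simp [classFinset]

open Classical in
/-- Every class that the index `i` cuts gets merged with another one, so adding `i` removes at
least half as many classes as `i` cuts. -/
lemma numClasses_insert_add_le [Fintype ι] [DecidableEq ι] (a : ι → V → A) (J : Finset ι) (i : ι) :
    2 * numClasses a (insert i J) +
      ((Finset.univ : Finset (Quotient (joinKer a J))).filter
        fun q => i ∈ boundaryIndices a (classFinset _ q)).card ≤ 2 * numClasses a J := by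
  have hle : joinKer a J ≤ joinKer a (insert i J) := joinKer_mono a (Finset.subset_insert i J)
  have hf : Function.Surjective (Quotient.map' (s₁ := joinKer a J) (s₂ := joinKer a (insert i J))
      id fun x y h => hle h) := by
    intro q
    obtain ⟨x, rfl⟩ := Quotient.mk_surjective q
    exact ⟨Quotient.mk _ x, rfl⟩
  rw [numClasses, numClasses, Nat.card_eq_fintype_card, Nat.card_eq_fintype_card]
  refine two_mul_card_add_card_le_of_surjective hf _ fun q hq => ?_
  simp only [Finset.mem_filter, Finset.mem_univ, true_and, boundaryIndices, mem_classFinset] at hq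
  obtain ⟨x, rfl, y, hy, hxy⟩ := hq
  refine ⟨Quotient.mk _ y, hy, ?_⟩
  exact Quotient.sound (ker_le_joinKer a (Finset.mem_insert_self i J) hxy.symm)

lemma notMem_of_mem_boundaryIndices [Fintype ι] {a : ι → V → A} {J : Finset ι} {i : ι}
    {q : Quotient (joinKer a J)} (h : i ∈ boundaryIndices a (classFinset _ q)) : i ∉ J := by
  intro hi
  simp only [boundaryIndices, Finset.mem_filter, Finset.mem_univ, true_and, mem_classFinset] at h
  obtain ⟨x, rfl, y, hy, hxy⟩ := h
  exact hy (Quotient.sound (ker_le_joinKer a hi hxy.symm))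

lemma card_mul_log_card_le_sum_log [Nonempty V] (r : Setoid V) [Fintype (Quotient r)] :
    (Fintype.card (Quotient r) : ℝ) * Real.log (Fintype.card (Quotient r)) ≤
      ∑ q : Quotient r, Real.log (Fintype.card V / (classFinset r q).card) := by
  classical
  have : Nonempty (Quotient r) := (‹Nonempty V›).map (Quotient.mk r)
  set c := Fintype.card (Quotient r)
  have hc : (0 : ℝ) < c := by
    have : 0 < Fintype.card (Quotient r) := Fintype.card_pos
    exact_mod_cast this
  have hV : (0 : ℝ) < Fintype.card V := by exact_mod_cast Fintype.card_pos
  have hsum : ∑ q : Quotient r, ((classFinset r q).card : ℝ) = Fintype.card V := by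
    rw [← Finset.card_univ, Finset.card_eq_sum_card_fiberwise
      (f := Quotient.mk r) (t := Finset.univ) fun _ _ => Finset.mem_coe.2 (Finset.mem_univ _)]
    push_cast
    refine Finset.sum_congr rfl fun q _ => ?_
    congr 2
  have hterm : ∀ q : Quotient r, Real.log c + (1 - c * (classFinset r q).card / Fintype.card V) ≤
      Real.log (Fintype.card V / (classFinset r q).card) := by
    intro q
    have hq : (0 : ℝ) < (classFinset r q).card := by
      obtain ⟨x, rfl⟩ := Quotient.mk_surjective q
      exact_mod_cast Finset.card_pos.2 ⟨x, mem_classFinset.2 rfl⟩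
    have h1 := Real.one_sub_inv_le_log_of_pos (x := Fintype.card V / (c * (classFinset r q).card))
      (by positivity)
    rw [inv_div] at h1
    have h2 : (Fintype.card V : ℝ) / (classFinset r q).card =
        c * (Fintype.card V / (c * (classFinset r q).card)) := by field_simp
    rw [h2, Real.log_mul hc.ne' (by positivity)]
    linarith
  calc (c : ℝ) * Real.log c
      = ∑ q : Quotient r, (Real.log c + (1 - c * (classFinset r q).card / Fintype.card V)) := by
        rw [Finset.sum_add_distrib, Finset.sum_sub_distrib, ← Finset.sum_div, ← Finset.mul_sum,
          hsum]
        simp only [Finset.sum_const, Finset.card_univ, nsmul_eq_mul, mul_one]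
        rw [mul_div_assoc, div_self hV.ne']
        ring
    _ ≤ _ := Finset.sum_le_sum fun q _ => hterm q

/-- If every set `S` is cut by many indices, then a further index decreases the number of classes
substantially on average. -/
lemma mul_log_numClasses_le_sum [Fintype ι] [DecidableEq ι] [Nonempty V] {a : ι → V → A} {lam : ℝ}
    (hlam : 0 ≤ lam)
    (hexp : ∀ S : Finset V, S.Nonempty →
      lam * Real.log (Fintype.card V / S.card) ≤ (boundaryIndices a S).card)
    (J : Finset ι) :
    lam / 2 * (numClasses a J * Real.log (numClasses a J)) ≤
      ∑ i ∈ Jᶜ, ((numClasses a J : ℝ) - numClasses a (insert i J)) := by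
  classical
  have h1 : ∀ i, ((((Finset.univ : Finset (Quotient (joinKer a J))).filter
        fun q => i ∈ boundaryIndices a (classFinset _ q)).card : ℕ) : ℝ) / 2 ≤
      (numClasses a J : ℝ) - numClasses a (insert i J) := by
    intro i
    have h := numClasses_insert_add_le a J i
    have h' : (2 : ℝ) * numClasses a (insert i J) +
        (((Finset.univ : Finset (Quotient (joinKer a J))).filter fun
          q => i ∈ boundaryIndices a (classFinset _ q)).card : ℕ) ≤ 2 * numClasses a J := by
      exact_mod_cast h
    linarith
  refine le_trans ?_ (Finset.sum_le_sum fun i _ => h1 i)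
  rw [← Finset.sum_div, ← Nat.cast_sum]
  have h2 : ∑ i ∈ Jᶜ, ((Finset.univ : Finset (Quotient (joinKer a J))).filter
        fun q => i ∈ boundaryIndices a (classFinset _ q)).card =
      ∑ q : Quotient (joinKer a J), (boundaryIndices a (classFinset _ q)).card := by
    have := Finset.sum_card_bipartiteAbove_eq_sum_card_bipartiteBelow (s := Jᶜ)
      (t := (Finset.univ : Finset (Quotient (joinKer a J))))
      (fun i q => i ∈ boundaryIndices a (classFinset _ q))
    simp only [Finset.bipartiteAbove, Finset.bipartiteBelow] at this
    rw [this]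
    refine Finset.sum_congr rfl fun q _ => ?_
    congr 1
    ext i
    simp only [Finset.mem_filter, Finset.mem_compl, and_iff_right_iff_imp]
    exact notMem_of_mem_boundaryIndices
  rw [h2]
  have h3 := card_mul_log_card_le_sum_log (joinKer a J)
  rw [← Nat.card_eq_fintype_card, ← numClasses] at h3
  have h4 : lam * ∑ q : Quotient (joinKer a J),
      Real.log (Fintype.card V / (classFinset (joinKer a J) q).card) ≤
      ((∑ q : Quotient (joinKer a J), (boundaryIndices a (classFinset _ q)).card : ℕ) : ℝ) := by
    rw [Finset.mul_sum, Nat.cast_sum]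
    refine Finset.sum_le_sum fun q _ => hexp _ ?_
    obtain ⟨x, rfl⟩ := Quotient.mk_surjective q
    exact ⟨x, mem_classFinset.2 rfl⟩
  have h5 := mul_le_mul_of_nonneg_left h3 hlam
  linarith

end Join

section Average

variable {ι V A : Type*} [Fintype ι] [DecidableEq ι]

/-- The expected number of classes of `joinKer` for a uniformly random set of indices of the same
size as `B`, realised as the image of `B` under a uniformly random permutation. Using permutations
allows to treat several disjoint sets `B` at once. -/
noncomputable def avgClasses (a : ι → V → A) (B : Finset ι) : ℝ :=
  (∑ σ : Equiv.Perm ι, (numClasses a (B.map σ.toEmbedding) : ℝ)) / (Fintype.card ι).factorial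

/-- Given the image of `B` under a random permutation `σ`, the value `σ j` at a further point `j`
is uniformly distributed on the complement of that image. -/
lemma sum_perm_sum_compl {B : Finset ι} {j : ι} (hj : j ∉ B) (h : ι → Finset ι → ℝ) :
    ∑ σ : Equiv.Perm ι, ∑ i ∈ (B.map σ.toEmbedding)ᶜ, h i (B.map σ.toEmbedding) =
      (Bᶜ.card : ℝ) * ∑ σ : Equiv.Perm ι, h (σ j) (B.map σ.toEmbedding) := by
  have h1 : ∀ σ : Equiv.Perm ι, ∑ i ∈ (B.map σ.toEmbedding)ᶜ, h i (B.map σ.toEmbedding) =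
      ∑ k ∈ Bᶜ, h (σ k) (B.map σ.toEmbedding) := by
    intro σ
    have : (B.map σ.toEmbedding)ᶜ = Bᶜ.map σ.toEmbedding := by
      ext x
      simp only [Finset.mem_compl, Finset.mem_map_equiv]
    rw [this, Finset.sum_map]
    rfl
  rw [Finset.sum_congr rfl fun σ _ => h1 σ, Finset.sum_comm, ← nsmul_eq_mul]
  refine Finset.sum_eq_card_nsmul fun k hk => ?_
  rw [Finset.mem_compl] at hk
  refine Fintype.sum_equiv (Equiv.mulRight (Equiv.swap j k)) _ _ fun σ => ?_
  have h2 : B.map (σ * Equiv.swap j k).toEmbedding = B.map σ.toEmbedding := by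
    rw [Finset.map_eq_image, Finset.map_eq_image]
    refine Finset.image_congr fun x hx => ?_
    have hx' : x ∈ B := hx
    simp only [Equiv.coe_toEmbedding, Equiv.Perm.coe_mul, Function.comp_apply]
    rw [Equiv.swap_apply_of_ne_of_ne]
    · rintro rfl; exact hj hx'
    · rintro rfl; exact hk hx'
  simp [h2]

variable [Fintype V] [Nonempty V]

lemma one_le_avgClasses (a : ι → V → A) (B : Finset ι) : 1 ≤ avgClasses a B := by
  have hfac : (0 : ℝ) < (Fintype.card ι).factorial := by exact_mod_cast Nat.factorial_pos _
  rw [avgClasses, le_div_iff₀ hfac, one_mul]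
  calc ((Fintype.card ι).factorial : ℝ) = ∑ _σ : Equiv.Perm ι, (1 : ℝ) := by
        simp [Fintype.card_perm]
    _ ≤ _ := Finset.sum_le_sum fun σ _ => by exact_mod_cast numClasses_pos a _

/-- Adding a random index to the random set decreases the expected number of classes `G` by at
least `λ G log G / (2n)`, by convexity of `x log x`. -/
lemma avgClasses_insert_le {a : ι → V → A} {lam : ℝ} (hlam : 0 ≤ lam)
    (hexp : ∀ S : Finset V, S.Nonempty →
      lam * Real.log (Fintype.card V / S.card) ≤ (boundaryIndices a S).card)
    {B : Finset ι} {j : ι} (hj : j ∉ B) :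
    lam / (2 * Fintype.card ι) * (avgClasses a B * Real.log (avgClasses a B)) ≤
      avgClasses a B - avgClasses a (insert j B) := by
  set G := avgClasses a B with hG
  have hG1 : 1 ≤ G := one_le_avgClasses a B
  have hG0 : 0 < G := by linarith
  have hfac : (0 : ℝ) < (Fintype.card ι).factorial := by exact_mod_cast Nat.factorial_pos _
  have hn : (0 : ℝ) < Fintype.card ι := by exact_mod_cast Fintype.card_pos_iff.2 ⟨j⟩
  have hsumG : ∑ σ : Equiv.Perm ι, (numClasses a (B.map σ.toEmbedding) : ℝ) =
      (Fintype.card ι).factorial * G := by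
    rw [hG, avgClasses]; field_simp
  have hsumG' : ∑ σ : Equiv.Perm ι, (numClasses a (insert (σ j) (B.map σ.toEmbedding)) : ℝ) =
      (Fintype.card ι).factorial * avgClasses a (insert j B) := by
    rw [avgClasses, mul_div_cancel₀ _ hfac.ne']
    refine Finset.sum_congr rfl fun σ _ => ?_
    rw [Finset.map_insert]; rfl
  -- the tangent line of `x log x` at `G`
  have htangent : ∀ σ : Equiv.Perm ι,
      (numClasses a (B.map σ.toEmbedding) : ℝ) * (Real.log G + 1) - G ≤
        numClasses a (B.map σ.toEmbedding) * Real.log (numClasses a (B.map σ.toEmbedding)) := by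
    intro σ
    have hc : (0 : ℝ) < numClasses a (B.map σ.toEmbedding) := by
      exact_mod_cast numClasses_pos a _
    set c : ℝ := (numClasses a (B.map σ.toEmbedding) : ℝ)
    have h1 := Real.one_sub_inv_le_log_of_pos (x := c / G) (by positivity)
    rw [inv_div, Real.log_div hc.ne' hG0.ne'] at h1
    have h2 := mul_le_mul_of_nonneg_left h1 hc.le
    have h3 : c * (1 - G / c) = c - G := by field_simp
    rw [h3] at h2
    linarith
  have hjensen : (Fintype.card ι).factorial * (G * Real.log G) ≤ ∑ σ : Equiv.Perm ι,
      (numClasses a (B.map σ.toEmbedding) : ℝ) * Real.log (numClasses a (B.map σ.toEmbedding)) := by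
    refine le_trans (le_of_eq ?_) (Finset.sum_le_sum fun σ _ => htangent σ)
    rw [Finset.sum_sub_distrib, ← Finset.sum_mul, hsumG]
    simp only [Finset.sum_const, Finset.card_univ, Fintype.card_perm, nsmul_eq_mul]
    ring
  have hstep := Finset.sum_le_sum fun (σ : Equiv.Perm ι) (_ : σ ∈ Finset.univ) =>
    mul_log_numClasses_le_sum hlam hexp (B.map σ.toEmbedding)
  rw [← Finset.mul_sum, sum_perm_sum_compl hj
    (fun i J => (numClasses a J : ℝ) - numClasses a (insert i J)), Finset.sum_sub_distrib,
    hsumG, hsumG', ← mul_sub] at hstep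
  have hle : lam / 2 * (G * Real.log G) ≤ (Bᶜ.card : ℝ) * (G - avgClasses a (insert j B)) := by
    refine le_of_mul_le_mul_left ?_ hfac
    have := mul_le_mul_of_nonneg_left hjensen (by linarith : (0 : ℝ) ≤ lam / 2)
    linarith
  have hlog : 0 ≤ lam / 2 * (G * Real.log G) :=
    mul_nonneg (by linarith) (mul_nonneg hG0.le (Real.log_nonneg hG1))
  have hBc : (0 : ℝ) < (Bᶜ.card : ℝ) := by
    exact_mod_cast Finset.card_pos.2 ⟨j, Finset.mem_compl.2 hj⟩
  have hdiff : 0 ≤ G - avgClasses a (insert j B) := by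
    by_contra hneg
    have := mul_neg_of_pos_of_neg hBc (not_le.1 hneg)
    linarith
  have hBn : (Bᶜ.card : ℝ) ≤ Fintype.card ι := by exact_mod_cast Finset.card_le_univ _
  have h4 := mul_le_mul_of_nonneg_right hBn hdiff
  have h5 : lam / (2 * Fintype.card ι) * (G * Real.log G) =
      (lam / 2 * (G * Real.log G)) / Fintype.card ι := by field_simp
  rw [h5, div_le_iff₀ hn]
  linarith

/-- The logarithm of the expected number of classes decays exponentially with the number of
indices. -/
lemma log_avgClasses_le {a : ι → V → A} {lam : ℝ} (hlam : 0 ≤ lam)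
    (hexp : ∀ S : Finset V, S.Nonempty →
      lam * Real.log (Fintype.card V / S.card) ≤ (boundaryIndices a S).card) (B : Finset ι) :
    Real.log (avgClasses a B) ≤
      Real.exp (-(lam / (2 * Fintype.card ι) * B.card)) * Real.log (Fintype.card V) := by
  induction B using Finset.induction_on with
  | empty =>
    simp only [Finset.card_empty, Nat.cast_zero, mul_zero, neg_zero, Real.exp_zero, one_mul]
    refine Real.log_le_log (by linarith [one_le_avgClasses a (∅ : Finset ι)]) ?_
    have hfac : (0 : ℝ) < (Fintype.card ι).factorial := by exact_mod_cast Nat.factorial_pos _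
    rw [avgClasses, div_le_iff₀ hfac]
    calc _ ≤ ∑ _σ : Equiv.Perm ι, (Fintype.card V : ℝ) :=
          Finset.sum_le_sum fun σ _ => by exact_mod_cast numClasses_le_card a _
      _ = _ := by simp [Fintype.card_perm, mul_comm]
  | insert j B hj ih =>
    have h1 := avgClasses_insert_le hlam hexp hj
    have hG1 := one_le_avgClasses a B
    have hG1' := one_le_avgClasses a (insert j B)
    set G := avgClasses a B
    set G' := avgClasses a (insert j B)
    set x := lam / (2 * Fintype.card ι)
    have hG0 : 0 < G := by linarith
    have h2 : Real.log G' - Real.log G ≤ G' / G - 1 := by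
      rw [← Real.log_div (by linarith) hG0.ne']
      exact Real.log_le_sub_one_of_pos (div_pos (by linarith) hG0)
    have h3 : G' / G - 1 ≤ -(x * Real.log G) := by
      rw [div_sub_one hG0.ne', div_le_iff₀ hG0]
      linarith
    have h4 : Real.log G' ≤ Real.exp (-x) * Real.log G := by
      have := mul_le_mul_of_nonneg_right (Real.add_one_le_exp (-x)) (Real.log_nonneg hG1)
      linarith
    calc Real.log G' ≤ Real.exp (-x) * Real.log G := h4
      _ ≤ Real.exp (-x) * (Real.exp (-(x * B.card)) * Real.log (Fintype.card V)) :=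
        mul_le_mul_of_nonneg_left ih (Real.exp_pos _).le
      _ = _ := by
        rw [← mul_assoc, ← Real.exp_add, Finset.card_insert_of_notMem hj]
        push_cast
        ring_nf

/-- If the expected excess numbers of classes of the parts of a partition of the indices add up to
less than one, then some permutation of the partition makes all parts connect everything. -/
lemma exists_partition_joinKer_eq_top {d : ℕ} (a : ι → V → A) (part : ι → Fin d)
    (h : ∀ k, avgClasses a (Finset.univ.filter fun i => part i = k) < 1 + 1 / d) :
    ∃ c : ι → Fin d, ∀ k, joinKer a (Finset.univ.filter fun i => c i = k) = ⊤ := by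
  rcases Nat.eq_zero_or_pos d with rfl | hd
  · exact ⟨part, fun k => k.elim0⟩
  have hd' : (0 : ℝ) < d := by exact_mod_cast hd
  have hfac : (0 : ℝ) < (Fintype.card ι).factorial := by exact_mod_cast Nat.factorial_pos _
  set P : Fin d → Finset ι := fun k => Finset.univ.filter fun i => part i = k with hP
  have h1 : ∑ σ : Equiv.Perm ι, ∑ k, ((numClasses a ((P k).map σ.toEmbedding) : ℝ) - 1) <
      ∑ _σ : Equiv.Perm ι, (1 : ℝ) := by
    rw [Finset.sum_comm]
    have h2 : ∀ k, ∑ σ : Equiv.Perm ι, ((numClasses a ((P k).map σ.toEmbedding) : ℝ) - 1) <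
        (Fintype.card ι).factorial * (1 / d) := by
      intro k
      have := h k
      rw [avgClasses, div_lt_iff₀ hfac] at this
      rw [Finset.sum_sub_distrib]
      simp only [Finset.sum_const, Finset.card_univ, Fintype.card_perm, nsmul_eq_mul, mul_one]
      linarith
    have : Nonempty (Fin d) := ⟨⟨0, hd⟩⟩
    refine (Finset.sum_lt_sum_of_nonempty Finset.univ_nonempty fun k _ => h2 k).trans_le ?_
    simp only [Finset.sum_const, Finset.card_univ, Fintype.card_perm, nsmul_eq_mul, mul_one,
      Fintype.card_fin]
    rw [mul_left_comm, mul_one_div_cancel hd'.ne', mul_one]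
  obtain ⟨σ, -, hσ⟩ := Finset.exists_lt_of_sum_lt h1
  have hnonneg : ∀ k, 0 ≤ (numClasses a ((P k).map σ.toEmbedding) : ℝ) - 1 := fun k => by
    have : (1 : ℝ) ≤ numClasses a ((P k).map σ.toEmbedding) := by
      exact_mod_cast numClasses_pos a _
    linarith
  refine ⟨fun i => part (σ.symm i), fun k => ?_⟩
  have hk : (numClasses a ((P k).map σ.toEmbedding) : ℝ) - 1 < 1 :=
    (Finset.single_le_sum (fun k _ => hnonneg k) (Finset.mem_univ k)).trans_lt hσ
  have hk' : numClasses a ((P k).map σ.toEmbedding) < 2 := by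
    have : (numClasses a ((P k).map σ.toEmbedding) : ℝ) < (2 : ℕ) := by push_cast; linarith
    exact_mod_cast this
  have heq : (Finset.univ.filter fun i => part (σ.symm i) = k) = (P k).map σ.toEmbedding := by
    ext i
    simp [hP, Finset.mem_map_equiv]
  rw [heq]
  exact joinKer_eq_top_of_numClasses_le_one (by omega)

end Average

/-- The indices of an expanding set split into `d` parts each of which connects the set. -/
theorem exists_partition_of_expanding {n d : ℕ} (hd : 1 ≤ d) (hn : 2 * d ≤ n) {V A : Type*}
    [Fintype V] [Nonempty V] {a : Fin n → V → A} {lam : ℝ} (hlam : 0 ≤ lam)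
    (hexp : ∀ S : Finset V, S.Nonempty →
      lam * Real.log (Fintype.card V / S.card) ≤ (boundaryIndices a S).card)
    (hV : 2 ≤ Fintype.card V)
    (hlarge : 4 * d * Real.log (2 * d * Real.log (Fintype.card V)) < lam) :
    ∃ c : Fin n → Fin d, ∀ k, joinKer a (Finset.univ.filter fun i => c i = k) = ⊤ := by
  have hd0 : (0 : ℝ) < d := by exact_mod_cast hd
  have hn0 : (0 : ℝ) < n := by exact_mod_cast (by omega : 0 < n)
  have hlogV : 0 < Real.log (Fintype.card V) :=
    Real.log_pos (by exact_mod_cast (by omega : 1 < Fintype.card V))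
  refine exists_partition_joinKer_eq_top a (fun i => ⟨i % d, Nat.mod_lt _ hd⟩) fun k => ?_
  set B : Finset (Fin n) := Finset.univ.filter fun i => (⟨i % d, Nat.mod_lt _ hd⟩ : Fin d) = k
  have hBnat : n / d ≤ B.card := by
    have hinj : ∀ m : Fin (n / d), d * m + k < n := fun m => by
      have h1 : d * (m + 1) ≤ d * (n / d) := Nat.mul_le_mul_left d m.2
      have h2 := Nat.mul_div_le n d
      have h3 := k.2
      rw [mul_add, mul_one] at h1
      omega
    have := Finset.card_le_card_of_injOn (s := (Finset.univ : Finset (Fin (n / d)))) (t := B)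
      (fun m => ⟨d * m + k, hinj m⟩) (fun m _ => by
        simp only [B, Finset.coe_filter, Finset.mem_univ, true_and, Set.mem_ofPred_eq]
        ext
        simp [Nat.mod_eq_of_lt k.2])
      (fun m _ m' _ h => by
        have h' : d * (m : ℕ) + k = d * m' + k := congrArg Fin.val h
        have : d * (m : ℕ) = d * m' := by omega
        exact Fin.ext (Nat.eq_of_mul_eq_mul_left hd this))
    simpa using this
  have hB : (n : ℝ) ≤ 2 * d * B.card := by
    have h1 : n < d * (n / d + 1) := by
      have := Nat.div_add_mod n d
      have := Nat.mod_lt n hd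
      rw [mul_add, mul_one]; omega
    have h2 : 1 ≤ n / d := (Nat.one_le_div_iff hd).2 (by omega)
    have h3 : d * (n / d + 1) ≤ d * (2 * B.card) := Nat.mul_le_mul_left d (by omega)
    have h4 : n ≤ 2 * d * B.card := by
      calc n ≤ d * (2 * B.card) := by omega
        _ = _ := by ring
    exact_mod_cast h4
  have h1 := log_avgClasses_le hlam hexp B
  have hexpo : Real.log (2 * d * Real.log (Fintype.card V)) <
      lam / (2 * Fintype.card (Fin n)) * B.card := by
    rw [Fintype.card_fin]
    have h2 : Real.log (2 * d * Real.log (Fintype.card V)) < lam / (4 * d) := by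
      rw [lt_div_iff₀ (by positivity)]; linarith
    refine h2.trans_le ?_
    rw [div_mul_eq_mul_div, div_le_div_iff₀ (by positivity) (by positivity)]
    have := mul_le_mul_of_nonneg_left hB hlam
    linarith
  have h2 : Real.log (avgClasses a B) < 1 / (2 * d) := by
    refine h1.trans_lt ?_
    have h3 : Real.exp (-(lam / (2 * Fintype.card (Fin n)) * B.card)) <
        (2 * d * Real.log (Fintype.card V))⁻¹ := by
      rw [Real.exp_neg]
      refine inv_strictAnti₀ (by positivity) ?_
      rw [← Real.log_lt_iff_lt_exp (by positivity)]
      exact hexpo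
    calc _ < (2 * d * Real.log (Fintype.card V))⁻¹ * Real.log (Fintype.card V) :=
          mul_lt_mul_of_pos_right h3 hlogV
      _ = _ := by field_simp
  have h3 : (1 : ℝ) / (2 * d) ≤ Real.log (1 + 1 / d) := by
    have h4 := Real.one_sub_inv_le_log_of_pos (x := 1 + 1 / (d : ℝ)) (by positivity)
    refine le_trans ?_ h4
    have h5 : (1 : ℝ) - (1 + 1 / (d : ℝ))⁻¹ = 1 / (d + 1) := by field_simp; ring
    rw [h5]
    have : (1 : ℝ) ≤ d := by exact_mod_cast hd
    exact one_div_le_one_div_of_le (by positivity) (by linarith)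
  have hpos : 0 < avgClasses a B := by linarith [one_le_avgClasses a B]
  exact (Real.log_lt_log_iff hpos (by positivity)).1 (h2.trans_le h3)

/-! ### Systems of linear equations along spanning trees -/

section TreeMatrix

/-- Let `s (y, j) = (parent, i)` assign to every vertex `y + 1` among `0, …, k` and every `j` a
parent vertex and an index. The square system of equations
`⟨φ i, v (y + 1) - v parent⟩ = 0` in the vectors `v 1, …, v k`, where `v 0 = 0`. -/
def treeMatrix {R : Type*} [CommRing R] {n d k : ℕ} (s : Fin k × Fin d → Fin (k + 1) × Fin n)
    (φ : Fin n → Fin d → R) : Matrix (Fin k × Fin d) (Fin k × Fin d) R :=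
  Matrix.of fun r u =>
    φ (s r).2 u.2 * ((if u.1 = r.1 then 1 else 0) - (if u.1.succ = (s r).1 then 1 else 0))

lemma treeMatrix_mulVec {R : Type*} [CommRing R] {n d k : ℕ}
    (s : Fin k × Fin d → Fin (k + 1) × Fin n) (φ : Fin n → Fin d → R)
    (v : Fin (k + 1) → Fin d → R) (hv : v 0 = 0) (r : Fin k × Fin d) :
    (treeMatrix s φ).mulVec (fun u => v u.1.succ u.2) r =
      ∑ j, φ (s r).2 j * (v r.1.succ j - v (s r).1 j) := by
  simp only [treeMatrix, Matrix.mulVec, dotProduct, Matrix.of_apply]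
  rw [Fintype.sum_prod_type_right]
  refine Finset.sum_congr rfl fun j _ => ?_
  have h1 : v (s r).1 j = ∑ y : Fin k, (if y.succ = (s r).1 then 1 else 0) * v y.succ j := by
    have := Fin.sum_univ_succ fun y : Fin (k + 1) => (if y = (s r).1 then 1 else 0) * v y j
    simp only [hv, Pi.zero_apply, mul_zero, zero_add] at this
    rw [← this]
    simp
  rw [h1, mul_sub, Finset.mul_sum]
  have h2 : v r.1.succ j = ∑ y : Fin k, (if y = r.1 then 1 else 0) * v y.succ j := by simp
  rw [h2, Finset.mul_sum, ← Finset.sum_sub_distrib]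
  refine Finset.sum_congr rfl fun y _ => ?_
  ring

variable (F : Type*) [Field F] {n d k : ℕ}

/-- The determinant of `treeMatrix s φ` as a polynomial in the entries of `φ`. -/
noncomputable def treeDet (s : Fin k × Fin d → Fin (k + 1) × Fin n) :
    MvPolynomial (Fin n × Fin d) F :=
  (treeMatrix s fun i j => MvPolynomial.X (i, j)).det

variable {F}

lemma eval_treeDet (s : Fin k × Fin d → Fin (k + 1) × Fin n) (φ : Fin n → Fin d → F) :
    MvPolynomial.eval (fun u => φ u.1 u.2) (treeDet F s) = (treeMatrix s φ).det := by
  rw [treeDet, RingHom.map_det]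
  congr 1
  ext r u
  simp [treeMatrix]

variable (F) in
lemma totalDegree_treeDet_le (s : Fin k × Fin d → Fin (k + 1) × Fin n) :
    (treeDet F s).totalDegree ≤ k * d := by
  rw [treeDet, Matrix.det_apply]
  refine MvPolynomial.totalDegree_finsetSum_le fun σ _ => ?_
  refine (MvPolynomial.totalDegree_smul_le _ _).trans ?_
  refine (MvPolynomial.totalDegree_finsetProd _ _).trans ?_
  calc _ ≤ ∑ _u : Fin k × Fin d, 1 := Finset.sum_le_sum fun u _ => ?_
    _ = k * d := by simp
  simp only [treeMatrix, Matrix.of_apply]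
  refine (MvPolynomial.totalDegree_mul _ _).trans ?_
  rw [MvPolynomial.totalDegree_X]
  have : ∀ P Q : Prop, ∀ [Decidable P] [Decidable Q],
      (((if P then 1 else 0) - (if Q then 1 else 0) :
        MvPolynomial (Fin n × Fin d) F)).totalDegree = 0 := by
    intro P Q _ _
    have h : ((if P then 1 else 0) - (if Q then 1 else 0) : MvPolynomial (Fin n × Fin d) F) =
        MvPolynomial.C ((if P then 1 else 0) - (if Q then 1 else 0)) := by
      split_ifs <;> simp
    rw [h, MvPolynomial.totalDegree_C]
  rw [this]

/-- If parents decrease some rank, the determinant is a nonzero polynomial: substituting the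
standard basis vector `e (c i)` for `φ i` turns the system into `d` independent systems, the
`j`-th of which says that the `j`-th coordinates of `v` agree along the `j`-th tree. -/
lemma treeDet_ne_zero (s : Fin k × Fin d → Fin (k + 1) × Fin n) (c : Fin n → Fin d)
    (hc : ∀ r, c (s r).2 = r.2) (ρ : Fin d → Fin (k + 1) → ℕ)
    (hρ : ∀ r, ρ r.2 (s r).1 < ρ r.2 r.1.succ) : treeDet F s ≠ 0 := by
  intro h0
  have hdet := eval_treeDet (F := F) s fun i j => if j = c i then 1 else 0
  rw [h0, map_zero] at hdet
  obtain ⟨w, hw, hmul⟩ := Matrix.exists_mulVec_eq_zero_iff.2 hdet.symm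
  set v : Fin (k + 1) → Fin d → F := Fin.cons 0 fun y j => w (y, j) with hv
  have hv0 : v 0 = 0 := by simp [hv]
  have hvs : ∀ y j, v (Fin.succ y) j = w (y, j) := fun y j => by simp [hv]
  have hparent : ∀ r : Fin k × Fin d, v r.1.succ r.2 = v (s r).1 r.2 := by
    intro r
    have h1 := treeMatrix_mulVec s (fun i j => if j = c i then (1 : F) else 0) v hv0 r
    have h2 : (fun u : Fin k × Fin d => v u.1.succ u.2) = w := by
      ext u; exact hvs u.1 u.2
    rw [h2, hmul] at h1
    simp only [hc, ite_mul, one_mul, zero_mul, Finset.sum_ite_eq', Finset.mem_univ, if_true,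
      Pi.zero_apply] at h1
    exact sub_eq_zero.1 h1.symm
  have hzero : ∀ m y j, ρ j y = m → v y j = 0 := by
    intro m
    induction m using Nat.strong_induction_on with
    | _ m ih =>
      intro y j hm
      refine Fin.cases (fun _ => by simp [hv0]) (fun y hm => ?_) y hm
      rw [hparent (y, j)]
      exact ih _ (hm ▸ hρ (y, j)) _ _ rfl
  exact hw (funext fun u => by rw [← hvs u.1 u.2, hzero _ _ _ rfl]; rfl)

/-- The determinant vanishes if the equations have a solution in distinct vectors. -/
lemma det_treeMatrix_eq_zero (s : Fin k × Fin d → Fin (k + 1) × Fin n) (φ : Fin n → Fin d → F)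
    (x : Fin (k + 1) → Fin d → F) {y : Fin k} (hx : x y.succ ≠ x 0)
    (h : ∀ r, φ (s r).2 ⬝ᵥ x r.1.succ = φ (s r).2 ⬝ᵥ x (s r).1) :
    (treeMatrix s φ).det = 0 := by
  rw [← Matrix.exists_mulVec_eq_zero_iff]
  refine ⟨fun u => (x u.1.succ - x 0) u.2, ?_, ?_⟩
  · intro h0
    refine hx (sub_eq_zero.1 (funext fun j => ?_))
    exact congrFun h0 (y, j)
  · ext r
    rw [treeMatrix_mulVec s φ (fun y => x y - x 0) (by simp)]
    simp only [Pi.sub_apply, sub_sub_sub_cancel_right, Pi.zero_apply, mul_sub,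
      Finset.sum_sub_distrib]
    exact sub_eq_zero.2 (h r)

/-- A partition of the indices into `d` parts, each of which connects the vertices `0, …, k`,
yields a system with nonzero determinant polynomial: take the breadth-first search tree from `0`
for each of the parts. -/
lemma exists_treeDet_ne_zero {A : Type*} (a : Fin n → Fin (k + 1) → A) (c : Fin n → Fin d)
    (hc : ∀ j, joinKer a (Finset.univ.filter fun i => c i = j) = ⊤) :
    ∃ s : Fin k × Fin d → Fin (k + 1) × Fin n, treeDet F s ≠ 0 ∧
      ∀ r, a (s r).2 r.1.succ = a (s r).2 (s r).1 := by
  set H : Fin d → SimpleGraph (Fin (k + 1)) := fun j =>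
    SimpleGraph.fromRel fun x y => ∃ i, c i = j ∧ a i x = a i y with hH
  have hconn : ∀ j, (H j).Connected := by
    intro j
    have h1 : joinKer a (Finset.univ.filter fun i => c i = j) ≤ (H j).reachableSetoid := by
      refine iSup₂_le fun i hi x y hxy => ?_
      rcases eq_or_ne x y with rfl | hne
      · exact SimpleGraph.Reachable.refl x
      · refine SimpleGraph.Adj.reachable ?_
        rw [hH, SimpleGraph.fromRel_adj]
        exact ⟨hne, Or.inl ⟨i, by simpa using hi, hxy⟩⟩
    rw [hc j] at h1
    exact (SimpleGraph.connected_iff _).2 ⟨fun x y => h1 trivial, inferInstance⟩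
  have hpar : ∀ r : Fin k × Fin d, ∃ t : Fin (k + 1) × Fin n, c t.2 = r.2 ∧
      a t.2 r.1.succ = a t.2 t.1 ∧ (H r.2).dist t.1 0 < (H r.2).dist r.1.succ 0 := by
    intro r
    obtain ⟨w, hw⟩ := (hconn r.2).exists_walk_length_eq_dist r.1.succ 0
    cases w with
    | cons hadj w' =>
      rename_i x
      rw [SimpleGraph.Walk.length_cons] at hw
      have hlt : (H r.2).dist x 0 < (H r.2).dist r.1.succ 0 := by
        have := (H r.2).dist_le w'
        omega
      obtain ⟨-, ⟨i, hi, hxy⟩ | ⟨i, hi, hxy⟩⟩ := (SimpleGraph.fromRel_adj _ _ _).1 hadj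
      · exact ⟨(x, i), hi, hxy, hlt⟩
      · exact ⟨(x, i), hi, hxy.symm, hlt⟩
  choose s hs1 hs2 hs3 using hpar
  exact ⟨s, treeDet_ne_zero s c hs1 (fun j y => (H j).dist y 0) hs3, hs2⟩

/-- The linear forms `φ 0, …, φ (n - 1)` avoid the zeros of all nonzero determinant polynomials of
systems on at most `M + 1` vertices. -/
def IsTreeGeneric (M : ℕ) (φ : Fin n → Fin d → F) : Prop :=
  ∀ k, 1 ≤ k → k ≤ M → ∀ s : Fin k × Fin d → Fin (k + 1) × Fin n,
    treeDet F s ≠ 0 → (treeMatrix s φ).det ≠ 0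

/-- The system on two vertices given by the first `d` of the linear forms shows that generic
linear forms separate vectors. -/
lemma IsTreeGeneric.eq_zero_of_dotProduct {M : ℕ} {φ : Fin n → Fin d → F}
    (h : IsTreeGeneric M φ) (hM : 1 ≤ M) (hd : 1 ≤ d) (hdn : d ≤ n) {v : Fin d → F}
    (hv : ∀ i, φ i ⬝ᵥ v = 0) : v = 0 := by
  by_contra hne
  set s : Fin 1 × Fin d → Fin 2 × Fin n := fun r => (0, Fin.castLE hdn r.2)
  refine h 1 le_rfl hM s ?_ ?_
  · refine treeDet_ne_zero s (fun i => if hi : (i : ℕ) < d then ⟨i, hi⟩ else ⟨0, hd⟩)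
      (fun r => by simp [s]) (fun _ y => y) fun r => by simp [s]
  · refine det_treeMatrix_eq_zero s φ (Fin.cons 0 fun _ => v) (y := 0) (by simpa using hne) ?_
    intro r
    simp [s, hv]

end TreeMatrix

/-! ### Counting generic families of linear forms -/

section Counting

lemma card_zeros_le {F σ : Type*} [Field F] [Fintype F] [DecidableEq F] [Fintype σ]
    [DecidableEq σ] {P : MvPolynomial σ F} (hP : P ≠ 0) :
    ((Finset.univ.filter fun f : σ → F => MvPolynomial.eval f P = 0).card : ℝ) *
      Fintype.card F ≤ P.totalDegree * (Fintype.card F : ℝ) ^ Fintype.card σ := by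
  set e := Fintype.equivFin σ
  have hP' : MvPolynomial.rename e P ≠ 0 := fun h =>
    hP (MvPolynomial.rename_injective e e.injective (by rw [h, map_zero]))
  have h := MvPolynomial.schwartz_zippel_totalDegree hP' (Finset.univ : Finset F)
  have hcard : (Finset.univ.filter fun f : σ → F => MvPolynomial.eval f P = 0).card =
      ((Fintype.piFinset fun _ : Fin (Fintype.card σ) => (Finset.univ : Finset F)).filter
        fun f => MvPolynomial.eval f (MvPolynomial.rename e P) = 0).card := by
    refine Finset.card_equiv (Equiv.arrowCongr e (Equiv.refl F)) fun f => ?_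
    simp only [Finset.mem_filter, Finset.mem_univ, true_and, Fintype.mem_piFinset, implies_true,
      MvPolynomial.eval_rename]
    have : (Equiv.arrowCongr e (Equiv.refl F)) f ∘ e = f := by
      ext u; simp
    rw [this]
  rw [← hcard, Finset.card_univ] at h
  have hF : (0 : ℚ≥0) < Fintype.card F := by exact_mod_cast Fintype.card_pos
  rw [div_le_div_iff₀ (pow_pos hF _) hF] at h
  have h2 : (MvPolynomial.rename e P).totalDegree ≤ P.totalDegree :=
    MvPolynomial.totalDegree_rename_le e P
  have h3 : (Finset.univ.filter fun f : σ → F => MvPolynomial.eval f P = 0).card *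
      Fintype.card F ≤ P.totalDegree * (Fintype.card F) ^ Fintype.card σ := by
    have h4 : (Finset.univ.filter fun f : σ → F => MvPolynomial.eval f P = 0).card *
      Fintype.card F ≤ (MvPolynomial.rename e P).totalDegree *
        (Fintype.card F) ^ Fintype.card σ := by exact_mod_cast h
    exact h4.trans (Nat.mul_le_mul_right _ h2)
  exact_mod_cast h3

open Classical in
/-- Union bound over all systems on at most `M + 1` vertices. -/
lemma card_not_isTreeGeneric_le {F : Type*} [Field F] [Fintype F] {n d : ℕ} (M : ℕ) (hn : 1 ≤ n) :
    ((Finset.univ.filter fun φ : Fin n → Fin d → F => ¬ IsTreeGeneric M φ).card : ℝ) *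
      Fintype.card F ≤
      (M * ((M + 1) * n) ^ (M * d) * (M * d) : ℕ) * (Fintype.card F : ℝ) ^ (n * d) := by
  set Z : (k : ℕ) → (Fin k × Fin d → Fin (k + 1) × Fin n) → Finset (Fin n → Fin d → F) :=
    fun k s => Finset.univ.filter fun φ => treeDet F s ≠ 0 ∧ (treeMatrix s φ).det = 0 with hZdef
  have hZ : ∀ k ∈ Finset.Icc 1 M, ∀ s : Fin k × Fin d → Fin (k + 1) × Fin n,
      ((Z k s).card : ℝ) * Fintype.card F ≤ (M * d : ℕ) * (Fintype.card F : ℝ) ^ (n * d) := by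
    intro k hk s
    by_cases h0 : treeDet F s = 0
    · have : Z k s = ∅ := by simp [hZdef, h0]
      rw [this, Finset.card_empty, Nat.cast_zero, zero_mul]
      positivity
    · have h1 : (Z k s).card =
          (Finset.univ.filter fun f : Fin n × Fin d → F =>
            MvPolynomial.eval f (treeDet F s) = 0).card := by
        refine Finset.card_equiv (Equiv.curry (Fin n) (Fin d) F).symm fun φ => ?_
        simp only [hZdef, Finset.mem_filter, Finset.mem_univ, true_and, ne_eq, h0,
          not_false_eq_true]
        rw [← eval_treeDet]
        rfl
      rw [h1]
      refine (card_zeros_le h0).trans ?_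
      rw [Fintype.card_prod, Fintype.card_fin, Fintype.card_fin]
      refine mul_le_mul_of_nonneg_right ?_ (by positivity)
      exact_mod_cast (totalDegree_treeDet_le F s).trans
        (Nat.mul_le_mul_right d (Finset.mem_Icc.1 hk).2)
  have hsub : (Finset.univ.filter fun φ : Fin n → Fin d → F => ¬ IsTreeGeneric M φ) ⊆
      (Finset.Icc 1 M).biUnion fun k => Finset.univ.biUnion fun s => Z k s := by
    intro φ hφ
    simp only [Finset.mem_filter, Finset.mem_univ, true_and, IsTreeGeneric, not_forall,
      not_not] at hφ
    obtain ⟨k, hk1, hkM, s, hs, hdet⟩ := hφ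
    simp only [Finset.mem_biUnion, Finset.mem_Icc, Finset.mem_univ, true_and]
    exact ⟨k, ⟨hk1, hkM⟩, s, by simp [hZdef, hs, hdet]⟩
  have h1 : ((Finset.univ.filter fun φ : Fin n → Fin d → F => ¬ IsTreeGeneric M φ).card : ℝ) ≤
      ∑ k ∈ Finset.Icc 1 M, ∑ s : Fin k × Fin d → Fin (k + 1) × Fin n, ((Z k s).card : ℝ) := by
    have h2 := (Finset.card_le_card hsub).trans (Finset.card_biUnion_le.trans
      (Finset.sum_le_sum fun k _ => Finset.card_biUnion_le))
    exact_mod_cast h2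
  have hF : (0 : ℝ) ≤ Fintype.card F := Nat.cast_nonneg _
  refine (mul_le_mul_of_nonneg_right h1 hF).trans ?_
  rw [Finset.sum_mul]
  calc _ ≤ ∑ k ∈ Finset.Icc 1 M, (((M + 1) * n) ^ (M * d) : ℕ) *
        ((M * d : ℕ) * (Fintype.card F : ℝ) ^ (n * d)) := by
        refine Finset.sum_le_sum fun k hk => ?_
        rw [Finset.sum_mul]
        refine (Finset.sum_le_sum fun s _ => hZ k hk s).trans ?_
        rw [Finset.sum_const, nsmul_eq_mul, Finset.card_univ]
        refine mul_le_mul_of_nonneg_right ?_ (by positivity)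
        have hkM := (Finset.mem_Icc.1 hk).2
        have : Fintype.card (Fin k × Fin d → Fin (k + 1) × Fin n) ≤
            ((M + 1) * n) ^ (M * d) := by
          simp only [Fintype.card_fun, Fintype.card_prod, Fintype.card_fin]
          calc ((k + 1) * n) ^ (k * d) ≤ ((M + 1) * n) ^ (k * d) :=
                Nat.pow_le_pow_left (Nat.mul_le_mul_right n (by omega)) _
            _ ≤ _ := Nat.pow_le_pow_right (Nat.mul_pos (by omega) hn)
                (Nat.mul_le_mul_right d hkM)
        exact_mod_cast this
    _ = _ := by
        rw [Finset.sum_const, Nat.card_Icc, Nat.add_sub_cancel, nsmul_eq_mul]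
        push_cast
        ring

end Counting

/-! ### List recoverability of codes given by generic linear forms -/

section ListRecovery

/-- Generic linear forms do not collapse small sets of vectors too much on average. -/
theorem IsTreeGeneric.collapse_lt {F : Type*} [Field F] [DecidableEq F] {n d M : ℕ}
    {φ : Fin n → Fin d → F} (h : IsTreeGeneric M φ) (hd : 1 ≤ d) (hn : 2 * d ≤ n)
    {X : Finset (Fin d → F)} (hX : 2 ≤ X.card) (hXM : X.card ≤ M + 1) {lam : ℝ} (hlam : 0 ≤ lam)
    (hlarge : 4 * d * Real.log (2 * d * Real.log X.card) < lam) :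
    collapse (fun i v => φ i ⬝ᵥ v) X < lam * (X.card * Real.log X.card) := by
  by_contra! hcol
  obtain ⟨Y, hYX, hY2, hexp⟩ := exists_expanding_subset _ X hX hcol hlam
  obtain ⟨k, hk⟩ : ∃ k, Y.card = k + 1 := ⟨Y.card - 1, by omega⟩
  set e : Fin (k + 1) ≃ Y := (Y.equivFinOfCardEq hk).symm
  set x : Fin (k + 1) ↪ (Fin d → F) := e.toEmbedding.trans (Function.Embedding.subtype _) with hx
  have hxY : ∀ y, x y ∈ Y := fun y => (e y).2
  have hYx : ∀ v ∈ Y, ∃ y, x y = v := fun v hv => ⟨e.symm ⟨v, hv⟩, by simp [hx]⟩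
  have hcardV : Fintype.card (Fin (k + 1)) = Y.card := by simp [hk]
  have hexp' : ∀ S : Finset (Fin (k + 1)), S.Nonempty →
      lam * Real.log (Fintype.card (Fin (k + 1)) / S.card) ≤
        (boundaryIndices (fun i y => φ i ⬝ᵥ x y) S).card := by
    intro S hS
    have hsub : S.map x ⊆ Y := by
      intro v hv
      obtain ⟨y, -, rfl⟩ := Finset.mem_map.1 hv
      exact hxY y
    have h1 := hexp (S.map x) hsub (hS.map)
    rw [Finset.card_map] at h1
    rw [hcardV]
    refine h1.trans ?_
    refine Nat.cast_le.2 (Finset.card_le_card fun i hi => ?_)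
    simp only [cutIndices, boundaryIndices, Finset.mem_filter, Finset.mem_univ, true_and,
      Finset.mem_map, Finset.mem_sdiff] at hi ⊢
    obtain ⟨_, ⟨y, hy, rfl⟩, v, ⟨hvY, hv⟩, hyv⟩ := hi
    obtain ⟨z, rfl⟩ := hYx v hvY
    exact ⟨y, hy, z, fun hz => hv ⟨z, hz, rfl⟩, hyv⟩
  have hlarge' : 4 * d * Real.log (2 * d * Real.log (Fintype.card (Fin (k + 1)))) < lam := by
    refine lt_of_le_of_lt ?_ hlarge
    rw [hcardV]
    have hd0 : (0 : ℝ) < d := by exact_mod_cast hd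
    have hY0 : (1 : ℝ) < Y.card := by exact_mod_cast hY2
    have hYX' : (Y.card : ℝ) ≤ X.card := by exact_mod_cast Finset.card_le_card hYX
    have hlogY := Real.log_pos hY0
    have := Real.log_le_log (by linarith) hYX'
    refine mul_le_mul_of_nonneg_left (Real.log_le_log (by positivity) ?_) (by positivity)
    exact mul_le_mul_of_nonneg_left this (by positivity)
  obtain ⟨c, hc⟩ := exists_partition_of_expanding hd hn hlam hexp' (by omega) hlarge'
  obtain ⟨s, hs, hsol⟩ := exists_treeDet_ne_zero (F := F) _ c hc
  have hkM : k ≤ M := by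
    have := Finset.card_le_card hYX
    omega
  refine h k (by omega) hkM s hs ?_
  refine det_treeMatrix_eq_zero s φ x (y := ⟨0, by omega⟩) (fun h0 => ?_) hsol
  exact Fin.succ_ne_zero _ (x.injective h0)

/-- If every element of `X` agrees with the sets `S i` of size `ℓ` in all but `α n` coordinates,
then the coordinate maps collapse `X`. -/
lemma le_collapse_of_agree {V A : Type*} [DecidableEq A] {n ℓ : ℕ} (a : Fin n → V → A)
    (X : Finset V) (S : Fin n → Finset A) (hS : ∀ i, (S i).card = ℓ) {α : ℝ}
    (hX : ∀ x ∈ X, ({i | a i x ∉ S i}.ncard : ℝ) ≤ α * n) :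
    (1 - α) * n * X.card - n * ℓ ≤ collapse a X := by
  have h1 : ∀ i, ((X.filter fun x => a i x ∈ S i).card : ℝ) - ℓ ≤
      (X.card : ℝ) - (X.image (a i)).card := by
    intro i
    have h2 : X.image (a i) ⊆ S i ∪ (X.filter fun x => a i x ∉ S i).image (a i) := by
      intro z hz
      obtain ⟨x, hx, rfl⟩ := Finset.mem_image.1 hz
      by_cases hxS : a i x ∈ S i
      · exact Finset.mem_union_left _ hxS
      · exact Finset.mem_union_right _
          (Finset.mem_image_of_mem _ (Finset.mem_filter.2 ⟨hx, hxS⟩))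
    have h3 : (X.image (a i)).card ≤ ℓ + (X.filter fun x => a i x ∉ S i).card := by
      refine (Finset.card_le_card h2).trans ((Finset.card_union_le _ _).trans ?_)
      rw [hS i]
      exact Nat.add_le_add_left Finset.card_image_le _
    have h4 := Finset.card_filter_add_card_filter_not (s := X) fun x => a i x ∈ S i
    have h5 : (X.image (a i)).card + (X.filter fun x => a i x ∈ S i).card ≤ ℓ + X.card := by omega
    have h6 : ((X.image (a i)).card : ℝ) + (X.filter fun x => a i x ∈ S i).card ≤ ℓ + X.card := by
      exact_mod_cast h5
    linarith
  have h7 : ∑ i, ((X.filter fun x => a i x ∈ S i).card : ℝ) =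
      ∑ x ∈ X, ((Finset.univ.filter fun i => a i x ∈ S i).card : ℝ) := by
    have := Finset.sum_card_bipartiteAbove_eq_sum_card_bipartiteBelow (s := X)
      (t := (Finset.univ : Finset (Fin n))) fun x i => a i x ∈ S i
    simp only [Finset.bipartiteAbove, Finset.bipartiteBelow] at this
    exact_mod_cast this.symm
  have h8 : ∀ x ∈ X, (1 - α) * n ≤ ((Finset.univ.filter fun i => a i x ∈ S i).card : ℝ) := by
    intro x hx
    have h9 := hX x hx
    have h10 : {i | a i x ∉ S i} = ((Finset.univ.filter fun i => a i x ∉ S i : Finset (Fin n)) :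
        Set (Fin n)) := by ext; simp
    rw [h10, Set.ncard_coe_finset] at h9
    have h11 := Finset.card_filter_add_card_filter_not (s := (Finset.univ : Finset (Fin n)))
      fun i => a i x ∈ S i
    rw [Finset.card_univ, Fintype.card_fin] at h11
    have h12 : ((Finset.univ.filter fun i => a i x ∈ S i).card : ℝ) +
      (Finset.univ.filter fun i => a i x ∉ S i).card = n := by exact_mod_cast h11
    linarith
  calc (1 - α) * n * X.card - n * ℓ = ∑ _x ∈ X, (1 - α) * n - n * ℓ := by
        rw [Finset.sum_const, nsmul_eq_mul]; ring
    _ ≤ ∑ i, ((X.filter fun x => a i x ∈ S i).card : ℝ) - n * ℓ := by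
        rw [h7]
        exact sub_le_sub_right (Finset.sum_le_sum h8) _
    _ = ∑ i, (((X.filter fun x => a i x ∈ S i).card : ℝ) - ℓ) := by
        rw [Finset.sum_sub_distrib]; simp
    _ ≤ _ := Finset.sum_le_sum fun i _ => h1 i

lemma IsTreeGeneric.isListRecoverable {F : Type*} [Field F] [Finite F] {n d M : ℕ}
    {φ : Fin n → Fin d → F} (h : IsTreeGeneric M φ) (hd : 1 ≤ d) (hn : 2 * d ≤ n)
    {α ε : ℝ} (hα : α ∈ Set.Ioo (0 : ℝ) 1) (hε : ε ∈ Set.Ioo (0 : ℝ) 1) {ℓ : ℕ} (hℓ : 1 ≤ ℓ)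
    (hM : 4 / (1 - α) * ℓ ≤ M)
    (hlarge : ∀ N : ℝ, 2 ≤ N → N ≤ 4 / (1 - α) * ℓ →
      4 * d * Real.log N * Real.log (2 * d * Real.log N) < (1 - α) * ε / (1 + ε) * n) :
    IsListRecoverable
      ((LinearMap.range (Matrix.toLin' (Matrix.of φ)) : Submodule F (Fin n → F)) :
        Set (Fin n → F)) α ℓ ((1 + ε) / (1 - α) * ℓ) := by
  classical
  have := Fintype.ofFinite F
  obtain ⟨hα0, hα1⟩ := hα
  obtain ⟨hε0, hε1⟩ := hε
  have h1α : 0 < 1 - α := by linarith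
  have hℓ' : (1 : ℝ) ≤ ℓ := by exact_mod_cast hℓ
  intro S hS
  refine ⟨Set.toFinite _, ?_⟩
  set L := (1 + ε) / (1 - α) * (ℓ : ℝ) with hL
  have hL1 : 1 ≤ L := by
    have h1 : 1 ≤ (1 + ε) / (1 - α) := by rw [le_div_iff₀ h1α]; linarith
    calc (1 : ℝ) = 1 * 1 := by ring
      _ ≤ _ := mul_le_mul h1 hℓ' (by norm_num) (by linarith)
  have hL2 : 2 * L ≤ 4 / (1 - α) * ℓ := by
    rw [hL, ← mul_assoc, mul_div_assoc']
    refine mul_le_mul_of_nonneg_right ?_ (by linarith)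
    exact div_le_div_of_nonneg_right (by linarith) h1α.le
  by_contra! hcon
  set G : (Fin d → F) → (Fin n → F) := fun v i => φ i ⬝ᵥ v with hG
  set Z : Finset (Fin d → F) := Finset.univ.filter fun v =>
    ({i | G v i ∉ S i}.ncard : ℝ) ≤ α * n with hZ
  have hsub : {x ∈ ((LinearMap.range (Matrix.toLin' (Matrix.of φ)) : Submodule F (Fin n → F)) :
      Set (Fin n → F)) | ({i | x i ∉ S i}.ncard : ℝ) ≤ α * n} ⊆ ((Z.image G : Finset _) : Set _) := by
    rintro x ⟨⟨v, rfl⟩, hx⟩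
    rw [Finset.coe_image]
    refine ⟨v, ?_, rfl⟩
    rw [Finset.mem_coe, hZ, Finset.mem_filter]
    exact ⟨Finset.mem_univ _, hx⟩
  have hZcard : L < Z.card := by
    refine hcon.trans_le ?_
    have h1 := Set.ncard_le_ncard hsub (Finset.finite_toSet _)
    rw [Set.ncard_coe_finset] at h1
    exact_mod_cast h1.trans Finset.card_image_le
  obtain ⟨X, hXZ, hXcard⟩ := Finset.exists_subset_card_eq
    (Nat.succ_le_of_lt ((Nat.floor_lt (by linarith)).2 hZcard))
  have hXL : L < X.card := by
    rw [hXcard]; push_cast; exact Nat.lt_floor_add_one L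
  have hXL2 : (X.card : ℝ) ≤ 2 * L := by
    rw [hXcard]; push_cast
    linarith [Nat.floor_le (by linarith : 0 ≤ L)]
  have hX2 : 2 ≤ X.card := by
    have : (1 : ℝ) < X.card := by linarith
    exact_mod_cast this
  have hX2' : (2 : ℝ) ≤ X.card := by exact_mod_cast hX2
  have hlog : 0 < Real.log X.card := Real.log_pos (by linarith)
  have hXM : X.card ≤ M + 1 := by
    have : (X.card : ℝ) ≤ M := by linarith
    have : X.card ≤ M := by exact_mod_cast this
    omega
  have hcol := h.collapse_lt hd hn hX2 hXM
    (lam := (1 - α) * ε / (1 + ε) * n / Real.log X.card) (by positivity) (by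
      rw [lt_div_iff₀ hlog]
      have := hlarge X.card hX2' (by linarith)
      linarith)
  have hagree := le_collapse_of_agree (fun i v => φ i ⬝ᵥ v) X S hS (α := α) fun x hx =>
    (Finset.mem_filter.1 (hXZ hx)).2
  have hℓX : (ℓ : ℝ) ≤ (1 - α) / (1 + ε) * X.card := by
    have h1 : (ℓ : ℝ) = (1 - α) / (1 + ε) * L := by
      rw [hL]; field_simp
    rw [h1]
    exact mul_le_mul_of_nonneg_left hXL.le (by positivity)
  have h2 := mul_le_mul_of_nonneg_left hℓX (Nat.cast_nonneg (α := ℝ) n)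
  have h3 : (1 - α) * ε / (1 + ε) * n / Real.log X.card * (X.card * Real.log X.card) =
      (1 - α) * n * X.card - n * ((1 - α) / (1 + ε) * X.card) := by
    field_simp
    ring
  linarith

end ListRecovery

/-! ### Random subspaces as ranges of random injective maps -/

section RandomSubspace

variable {F : Type*} [Field F] {V W : Type*} [AddCommGroup V] [Module F V]
  [AddCommGroup W] [Module F W]

/-- Injective linear maps with range `C` are the same as isomorphisms onto `C`. -/
noncomputable def injectiveWithRangeEquiv (C : Submodule F W) :
    {f : V →ₗ[F] W // Function.Injective f ∧ LinearMap.range f = C} ≃ (V ≃ₗ[F] C) where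
  toFun f := (LinearEquiv.ofInjective f.1 f.2.1).trans (LinearEquiv.ofEq _ _ f.2.2)
  invFun g := ⟨C.subtype ∘ₗ g.toLinearMap, by
    constructor
    · exact C.injective_subtype.comp g.injective
    · rw [LinearMap.range_comp, LinearEquiv.range, Submodule.map_top, Submodule.range_subtype]⟩
  left_inv f := by
    ext x
    rfl
  right_inv g := by
    ext x
    rfl

open Classical in
/-- Every subspace of the right dimension is the range of the same number of injective maps. -/
lemma ncard_mul_card_linearEquiv [Finite V] [Finite W] (P : Submodule F W → Prop) :
    {C : Submodule F W | Module.finrank F C = Module.finrank F V ∧ P C}.ncard *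
      Nat.card (V ≃ₗ[F] V) =
      {f : V →ₗ[F] W | Function.Injective f ∧ P (LinearMap.range f)}.ncard := by
  have : Finite (V →ₗ[F] W) := Finite.of_injective _ DFunLike.coe_injective
  have := Fintype.ofFinite (V →ₗ[F] W)
  have := Fintype.ofFinite (Submodule F W)
  rw [Set.ncard_eq_toFinset_card', Set.ncard_eq_toFinset_card']
  rw [Finset.card_eq_sum_card_fiberwise (f := fun f : V →ₗ[F] W => LinearMap.range f)
    (t := {C : Submodule F W | Module.finrank F C = Module.finrank F V ∧ P C}.toFinset)]
  · rw [← smul_eq_mul]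
    refine (Finset.sum_eq_card_nsmul fun C hC => ?_).symm
    simp only [Set.mem_toFinset, Set.mem_ofPred_eq] at hC
    obtain ⟨e⟩ : Nonempty (C ≃ₗ[F] V) := ⟨LinearEquiv.ofFinrankEq _ _ hC.1⟩
    have h1 : Nat.card (V ≃ₗ[F] V) = Nat.card (V ≃ₗ[F] C) :=
      Nat.card_congr
        { toFun := fun g => g.trans e.symm
          invFun := fun g => g.trans e
          left_inv := fun g => by ext; simp
          right_inv := fun g => by ext; simp }
    rw [h1, ← Nat.card_congr (injectiveWithRangeEquiv (V := V) C), Nat.card_eq_fintype_card,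
      Fintype.card_subtype]
    congr 1
    ext f
    simp only [Finset.mem_filter, Set.mem_toFinset, Set.mem_ofPred_eq, Finset.mem_univ, true_and]
    constructor
    · rintro ⟨⟨h, -⟩, h'⟩
      exact ⟨h, h'⟩
    · rintro ⟨h, rfl⟩
      exact ⟨⟨h, hC.2⟩, rfl⟩
  · intro f hf
    simp only [Set.coe_toFinset, Set.mem_ofPred_eq] at hf ⊢
    exact ⟨LinearMap.finrank_range_of_inj hf.1, hf.2⟩

end RandomSubspace

open Classical in
/-- A property of the code `{(⟨φ 0, v⟩, …, ⟨φ (n - 1), v⟩)}` that holds for all but a proportion `ε`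
of the families `φ` of linear forms holds for a random code with probability at least `1 - ε`. -/
lemma one_sub_le_randomCodeProb {p n d : ℕ} [Fact p.Prime] {ε : ℝ} (hε : ε < 1)
    (P : Submodule (ZMod p) (Fin n → ZMod p) → Prop)
    (good : (Fin n → Fin d → ZMod p) → Prop)
    (hinj : ∀ φ, good φ → Function.Injective (Matrix.toLin' (Matrix.of φ)))
    (hP : ∀ φ, good φ → P (LinearMap.range (Matrix.toLin' (Matrix.of φ))))
    (hbad : ((Finset.univ.filter fun φ : Fin n → Fin d → ZMod p => ¬ good φ).card : ℝ) ≤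
      ε * (p : ℝ) ^ (n * d)) :
    1 - ε ≤ randomCodeProb p n d P := by
  have hA := ncard_mul_card_linearEquiv (F := ZMod p) (V := Fin d → ZMod p)
    (W := Fin n → ZMod p) P
  have hT := ncard_mul_card_linearEquiv (F := ZMod p) (V := Fin d → ZMod p)
    (W := Fin n → ZMod p) fun _ => True
  simp only [and_true, Module.finrank_fin_fun] at hA hT
  have : Finite ((Fin d → ZMod p) →ₗ[ZMod p] (Fin n → ZMod p)) :=
    Finite.of_injective _ DFunLike.coe_injective
  have hp0 : (0 : ℝ) < p := by exact_mod_cast (Fact.out : p.Prime).pos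
  have hcard : Fintype.card (Fin n → Fin d → ZMod p) = p ^ (n * d) := by
    simp [ZMod.card, ← pow_mul, mul_comm]
  have hgood : (1 - ε) * (p : ℝ) ^ (n * d) ≤
      (Finset.univ.filter fun φ : Fin n → Fin d → ZMod p => good φ).card := by
    have h1 := Finset.card_filter_add_card_filter_not
      (s := (Finset.univ : Finset (Fin n → Fin d → ZMod p))) fun φ => good φ
    rw [Finset.card_univ, hcard] at h1
    have h2 : ((Finset.univ.filter fun φ : Fin n → Fin d → ZMod p => good φ).card : ℝ) +
      (Finset.univ.filter fun φ : Fin n → Fin d → ZMod p => ¬ good φ).card = (p : ℝ) ^ (n * d) := by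
      exact_mod_cast h1
    linarith
  set toMap : (Fin n → Fin d → ZMod p) → ((Fin d → ZMod p) →ₗ[ZMod p] (Fin n → ZMod p)) :=
    fun φ => Matrix.toLin' (Matrix.of φ)
  have hmapinj : Function.Injective toMap :=
    Matrix.toLin'.injective.comp Matrix.of.injective
  have hgoodA : (Finset.univ.filter fun φ : Fin n → Fin d → ZMod p => good φ).card ≤
      {f : (Fin d → ZMod p) →ₗ[ZMod p] (Fin n → ZMod p) |
        Function.Injective f ∧ P (LinearMap.range f)}.ncard := by
    rw [← Finset.card_image_of_injective _ hmapinj, ← Set.ncard_coe_finset]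
    refine Set.ncard_le_ncard ?_ (Set.toFinite _)
    intro f hf
    rw [Finset.mem_coe, Finset.mem_image] at hf
    obtain ⟨φ, hφ, rfl⟩ := hf
    have hφ' := (Finset.mem_filter.1 hφ).2
    exact ⟨hinj φ hφ', hP φ hφ'⟩
  have hTle : {f : (Fin d → ZMod p) →ₗ[ZMod p] (Fin n → ZMod p) |
      Function.Injective f}.ncard ≤ p ^ (n * d) := by
    rw [← hcard, ← Nat.card_eq_fintype_card]
    refine (Set.ncard_le_card _).trans ?_
    exact (Nat.card_congr (Matrix.toLin' (R := ZMod p) (m := Fin n) (n := Fin d)).toEquiv).ge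
  have hb : 0 < Nat.card ((Fin d → ZMod p) ≃ₗ[ZMod p] (Fin d → ZMod p)) := by
    have : Finite ((Fin d → ZMod p) ≃ₗ[ZMod p] (Fin d → ZMod p)) :=
      Finite.of_injective _ DFunLike.coe_injective
    exact Nat.card_pos
  set b := Nat.card ((Fin d → ZMod p) ≃ₗ[ZMod p] (Fin d → ZMod p))
  set N := {C : Submodule (ZMod p) (Fin n → ZMod p) |
    Module.finrank (ZMod p) C = d ∧ P C}.ncard with hN
  set T := {C : Submodule (ZMod p) (Fin n → ZMod p) | Module.finrank (ZMod p) C = d}.ncard with hTdef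
  have hprob : randomCodeProb p n d P = (N : ℝ) / T := rfl
  have hb' : (0 : ℝ) < b := by exact_mod_cast hb
  have hNb : (1 - ε) * (p : ℝ) ^ (n * d) ≤ N * b := by
    refine hgood.trans ?_
    rw [← hA] at hgoodA
    exact_mod_cast hgoodA
  have hTb : (T : ℝ) * b ≤ (p : ℝ) ^ (n * d) := by
    rw [← hT] at hTle
    exact_mod_cast hTle
  have hNT : N ≤ T := Set.ncard_le_ncard (fun C hC => hC.1) (Set.toFinite _)
  have hN0 : 0 < N := by
    rcases Nat.eq_zero_or_pos N with h0 | h0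
    · rw [h0, Nat.cast_zero, zero_mul] at hNb
      exact absurd (mul_pos (sub_pos.2 hε) (pow_pos hp0 (n * d))) (not_lt.2 hNb)
    · exact h0
  have hT0 : (0 : ℝ) < T := by exact_mod_cast hN0.trans_le hNT
  rw [hprob, le_div_iff₀ hT0]
  refine le_of_mul_le_mul_right ?_ hb'
  calc (1 - ε) * T * b = (1 - ε) * (T * b) := by ring
    _ ≤ (1 - ε) * (p : ℝ) ^ (n * d) := mul_le_mul_of_nonneg_left hTb (by linarith)
    _ ≤ _ := hNb

/-! ### Choice of the parameters -/

lemma primrec₂_nat_pow : Primrec₂ ((· ^ ·) : ℕ → ℕ → ℕ) :=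
  Primrec₂.unpaired'.1 Nat.Primrec.pow

/-- The number of systems on at most `M + 1` vertices times the degree of their determinants. By the
Schwartz–Zippel lemma, at most a proportion `systemBound d M n / p` of the families of linear forms
over `𝔽_p` is not generic. -/
def systemBound (d M n : ℕ) : ℕ := M * ((M + 1) * n) ^ (M * d) * (M * d)

lemma computable_threshold (Q K d : ℕ) :
    Computable fun n => Q * systemBound d (K * 2 ^ n) n + 1 := by
  refine Primrec.to_comp ?_
  have hM : Primrec fun n : ℕ => K * 2 ^ n :=
    Primrec.nat_mul.comp (Primrec.const K) (primrec₂_nat_pow.comp (Primrec.const 2) Primrec.id)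
  have hMd : Primrec fun n : ℕ => K * 2 ^ n * d := Primrec.nat_mul.comp hM (Primrec.const d)
  have hbase : Primrec fun n : ℕ => (K * 2 ^ n + 1) * n :=
    Primrec.nat_mul.comp (Primrec.succ.comp hM) Primrec.id
  have hbound : Primrec fun n : ℕ => systemBound d (K * 2 ^ n) n :=
    Primrec.nat_mul.comp (Primrec.nat_mul.comp hM (primrec₂_nat_pow.comp hbase hMd)) hMd
  exact Primrec.succ.comp (Primrec.nat_mul.comp (Primrec.const Q) hbound)

/-- The length from which on lists of bounded size are handled; the term
`8 d log K log (4 d log K) / η` is what makes a random assignment of the coordinates to `d` parts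
connect sets of bounded size in each part. -/
noncomputable def lengthBound (η K : ℝ) (d : ℕ) : ℕ :=
  ⌈8 * d * Real.log K * Real.log (4 * d * Real.log K) / η⌉₊ + 2 * d + 3

lemma lengthBound_isBigO {η K : ℝ} (hη : 0 < η) (hK : 1 ≤ Real.log K) :
    (fun d : ℕ => (lengthBound η K d : ℝ)) =O[Filter.atTop]
      fun d : ℕ => (d : ℝ) * Real.log d := by
  have hc0 : 0 ≤ Real.log (4 * Real.log K) := Real.log_nonneg (by linarith)
  refine Asymptotics.IsBigO.of_bound
    (8 * Real.log K * (1 + Real.log (4 * Real.log K)) / η + 6) ?_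
  filter_upwards [Filter.eventually_ge_atTop 3] with d hd
  have hd3 : (3 : ℝ) ≤ d := by exact_mod_cast hd
  have hd0 : (0 : ℝ) < d := by linarith
  have hlogd : 1 ≤ Real.log d := by
    rw [Real.le_log_iff_exp_le hd0]
    linarith [Real.exp_one_lt_d9]
  have hdlog : (d : ℝ) ≤ d * Real.log d := le_mul_of_one_le_right hd0.le hlogd
  rw [Real.norm_of_nonneg (Nat.cast_nonneg _), Real.norm_of_nonneg (by linarith)]
  have hsplit : Real.log (4 * d * Real.log K) = Real.log d + Real.log (4 * Real.log K) := by
    rw [← Real.log_mul hd0.ne' (by linarith)]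
    congr 1; ring
  have hle : Real.log (4 * d * Real.log K) ≤ (1 + Real.log (4 * Real.log K)) * Real.log d := by
    rw [hsplit, add_mul, one_mul]
    linarith [le_mul_of_one_le_right hc0 hlogd]
  have hnum : 8 * d * Real.log K * Real.log (4 * d * Real.log K) / η ≤
      8 * Real.log K * (1 + Real.log (4 * Real.log K)) / η * (d * Real.log d) := by
    calc _ ≤ 8 * d * Real.log K * ((1 + Real.log (4 * Real.log K)) * Real.log d) / η :=
          div_le_div_of_nonneg_right
            (mul_le_mul_of_nonneg_left hle (mul_nonneg (by linarith) (by linarith))) hη.le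
      _ = _ := by ring
  have hnonneg : 0 ≤ 8 * d * Real.log K * Real.log (4 * d * Real.log K) / η := by
    rw [hsplit]
    exact div_nonneg (mul_nonneg (mul_nonneg (by linarith) (by linarith)) (by linarith)) hη.le
  have hceil := (Nat.ceil_lt_add_one hnonneg).le
  rw [lengthBound]
  push_cast
  linarith

/-- The expansion required for sets of `N` messages is available both if `N` is bounded, by the
choice of the length, and if `N` is bounded by `2 ^ (δ n / log n)`, by the choice of `δ`. -/
lemma four_mul_log_mul_log_lt {η K : ℝ} (hη0 : 0 < η) (hη1 : η ≤ 1) (hK0 : 0 < K)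
    (hK : 1 ≤ Real.log K) {d n : ℕ} (hd : 1 ≤ d) (hn : lengthBound η K d ≤ n) {N : ℝ}
    (hN2 : 2 ≤ N) (hN : N ≤ K * (2 : ℝ) ^ (η / (16 * d) * n / Real.log n)) :
    4 * d * Real.log N * Real.log (2 * d * Real.log N) < η * n := by
  have hd1 : (1 : ℝ) ≤ d := by exact_mod_cast hd
  have hn' : (8 * d * Real.log K * Real.log (4 * d * Real.log K) / η) + 2 * d + 3 ≤ n := by
    have h1 := Nat.le_ceil (8 * d * Real.log K * Real.log (4 * d * Real.log K) / η)
    have h2 : ((lengthBound η K d : ℕ) : ℝ) ≤ n := by exact_mod_cast hn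
    rw [lengthBound] at h2
    push_cast at h2
    linarith
  have hn3 : (3 : ℝ) ≤ n := by
    have : 3 ≤ n := le_trans (by rw [lengthBound]; omega) hn
    exact_mod_cast this
  have hlogn : 1 ≤ Real.log n := by
    rw [Real.le_log_iff_exp_le (by linarith)]
    linarith [Real.exp_one_lt_d9]
  have hlogN : 0 < Real.log N := Real.log_pos (by linarith)
  set t : ℝ := η / (16 * d) * n / Real.log n with ht
  have ht0 : 0 ≤ t := by positivity
  have hlogle : Real.log N ≤ Real.log K + t := by
    have h1 := Real.log_le_log (by linarith) hN
    rw [Real.log_mul hK0.ne' (by positivity), Real.log_rpow (by norm_num)] at h1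
    have h2 : t * Real.log 2 ≤ t := mul_le_of_le_one_right ht0 (by linarith [Real.log_two_lt_d9])
    linarith
  -- it suffices to bound `log N` by `B` and `log (2 d B)` by a nonnegative number
  have hbound : ∀ B P : ℝ, Real.log N ≤ B → Real.log (2 * d * B) ≤ P → 0 ≤ P →
      4 * d * B * P < η * n → 4 * d * Real.log N * Real.log (2 * d * Real.log N) < η * n := by
    intro B P hB hBP hP hlt
    have h1 : Real.log (2 * d * Real.log N) ≤ P :=
      (Real.log_le_log (by positivity)
        (mul_le_mul_of_nonneg_left hB (by positivity))).trans hBP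
    calc _ ≤ 4 * d * Real.log N * P := mul_le_mul_of_nonneg_left h1 (by positivity)
      _ ≤ 4 * d * B * P := mul_le_mul_of_nonneg_right
          (mul_le_mul_of_nonneg_left hB (by positivity)) hP
      _ < _ := hlt
  rcases le_total t (Real.log K) with hcase | hcase
  · refine hbound (2 * Real.log K) (Real.log (4 * d * Real.log K)) (by linarith)
      (le_of_eq (by ring_nf)) (Real.log_nonneg ?_) ?_
    · calc (1 : ℝ) ≤ 4 * 1 * 1 := by norm_num
        _ ≤ 4 * d * Real.log K :=
          mul_le_mul (by linarith) hK (by norm_num) (by linarith)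
    · have h1 : 8 * d * Real.log K * Real.log (4 * d * Real.log K) / η < n := by linarith
      rw [div_lt_iff₀ hη0] at h1
      linarith
  · refine hbound (2 * t) (Real.log n) (by linarith) ?_ (by linarith) ?_
    · have h1 : 2 * d * (2 * t) = η / 4 * n / Real.log n := by
        rw [ht]; field_simp; ring
      have ht1 : 0 < t := by linarith
      refine Real.log_le_log (by positivity) ?_
      rw [h1, div_le_iff₀ (by linarith)]
      have h2 : η / 4 * n ≤ 1 * n := mul_le_mul_of_nonneg_right (by linarith) (by linarith)
      have h3 : (n : ℝ) * 1 ≤ n * Real.log n := mul_le_mul_of_nonneg_left hlogn (by linarith)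
      linarith
    · have h1 : 4 * d * (2 * t) * Real.log n = η * n / 2 := by
        rw [ht]; field_simp; ring
      rw [h1]
      have : 0 < η * n := by positivity
      linarith

lemma rpow_div_log_le_two_pow {δ : ℝ} (hδ1 : δ ≤ 1) {n : ℕ} (hn : 3 ≤ n) :
    (2 : ℝ) ^ (δ * n / Real.log n) ≤ (2 : ℝ) ^ n := by
  have hn3 : (3 : ℝ) ≤ n := by exact_mod_cast hn
  have hlogn : 1 ≤ Real.log n := by
    rw [Real.le_log_iff_exp_le (by linarith)]
    linarith [Real.exp_one_lt_d9]
  rw [← Real.rpow_natCast]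
  refine Real.rpow_le_rpow_of_exponent_le (by norm_num) ?_
  rw [div_le_iff₀ (by linarith)]
  calc δ * n ≤ 1 * n := mul_le_mul_of_nonneg_right hδ1 (by linarith)
    _ ≤ n * Real.log n := by
      rw [one_mul]
      exact le_mul_of_one_le_right (by linarith) hlogn

theorem theorem1 (α ε : ℝ) (hα : α ∈ Set.Ioo (0 : ℝ) 1) (hε : ε ∈ Set.Ioo (0 : ℝ) 1) :
    ∃ n₀ : ℕ → ℕ,
      (fun d : ℕ => (n₀ d : ℝ)) =O[Filter.atTop] (fun d : ℕ => (d : ℝ) * Real.log (d : ℝ)) ∧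
      ∀ d : ℕ, 1 ≤ d → 1 ≤ n₀ d ∧
        ∃ δ : ℝ, 0 < δ ∧ ∃ f : ℕ → ℕ, Computable f ∧ (∀ n : ℕ, 1 ≤ f n) ∧
          ∀ n : ℕ, n₀ d ≤ n → ∀ (p : ℕ) [Fact p.Prime], f n ≤ p →
            1 - ε ≤ randomCodeProb p n d (fun C =>
              ∀ ℓ : ℕ, 1 ≤ ℓ → (ℓ : ℝ) ≤ (2 : ℝ) ^ (δ * (n : ℝ) / Real.log (n : ℝ)) →
                IsListRecoverable (C : Set (Fin n → ZMod p)) α ℓ ((1 + ε) / (1 - α) * (ℓ : ℝ))) := by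
  classical
  obtain ⟨hα0, hα1⟩ := hα
  obtain ⟨hε0, hε1⟩ := hε
  have h1α : 0 < 1 - α := by linarith
  set η : ℝ := (1 - α) * ε / (1 + ε) with hη
  have hη0 : 0 < η := by positivity
  have hη1 : η ≤ 1 := by
    rw [hη, div_le_one (by linarith)]
    have := mul_le_mul (by linarith : 1 - α ≤ 1) hε1.le hε0.le (by norm_num)
    linarith
  set K : ℝ := 4 / (1 - α) with hKdef
  have hK4 : 4 ≤ K := by
    rw [hKdef, le_div_iff₀ h1α]; linarith
  have hlogK : 1 ≤ Real.log K := by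
    rw [Real.le_log_iff_exp_le (by linarith)]
    linarith [Real.exp_one_lt_d9]
  refine ⟨lengthBound η K, lengthBound_isBigO hη0 hlogK, fun d hd =>
    ⟨by rw [lengthBound]; omega, η / (16 * d), ?_, fun n =>
      ⌈1 / ε⌉₊ * systemBound d (⌈K⌉₊ * 2 ^ n) n + 1, computable_threshold _ _ _,
      fun n => Nat.le_add_left 1 _, ?_⟩⟩
  · have : (1 : ℝ) ≤ d := by exact_mod_cast hd
    positivity
  intro n hn p _ hp
  have hn1 : 2 * d + 3 ≤ n := le_trans (by rw [lengthBound]; omega) hn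
  set M := ⌈K⌉₊ * 2 ^ n with hM
  have hM1 : 1 ≤ M := Nat.mul_pos (Nat.ceil_pos.2 (by linarith)) (by positivity)
  have hδ1 : η / (16 * d) ≤ 1 := by
    have : (1 : ℝ) ≤ d := by exact_mod_cast hd
    rw [div_le_one (by linarith)]; linarith
  refine one_sub_le_randomCodeProb hε1 _ (IsTreeGeneric M) (fun φ hφ => ?_)
    (fun φ hφ ℓ hℓ hℓn => ?_) ?_
  · rw [injective_iff_map_eq_zero]
    intro v hv
    exact hφ.eq_zero_of_dotProduct hM1 hd (by omega) fun i => congrFun hv i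
  · have hℓK : K * ℓ ≤ K * (2 : ℝ) ^ (η / (16 * d) * n / Real.log n) :=
      mul_le_mul_of_nonneg_left hℓn (by linarith)
    refine hφ.isListRecoverable hd (by omega) ⟨hα0, hα1⟩ ⟨hε0, hε1⟩ hℓ ?_ fun N hN2 hN => ?_
    · have h1 := hℓn.trans (rpow_div_log_le_two_pow hδ1 (by omega))
      rw [hM]
      push_cast
      exact mul_le_mul (Nat.le_ceil K) h1 (Nat.cast_nonneg _) (Nat.cast_nonneg _)
    · exact four_mul_log_mul_log_lt hη0 hη1 (by linarith) hlogK hd hn hN2 (hN.trans hℓK)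
  · have h1 := card_not_isTreeGeneric_le (F := ZMod p) (d := d) M (by omega : 1 ≤ n)
    rw [ZMod.card] at h1
    have hp0 : (0 : ℝ) < p := by exact_mod_cast (Fact.out : p.Prime).pos
    have hW : ((M * ((M + 1) * n) ^ (M * d) * (M * d) : ℕ) : ℝ) ≤ ε * p := by
      have h2 : ((⌈1 / ε⌉₊ * systemBound d M n + 1 : ℕ) : ℝ) ≤ p := by exact_mod_cast hp
      rw [Nat.cast_succ, Nat.cast_mul] at h2
      have h3 : 1 / ε * (systemBound d M n : ℝ) ≤ p :=
        (mul_le_mul_of_nonneg_right (Nat.le_ceil _) (Nat.cast_nonneg _)).trans (by linarith)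
      rw [div_mul_eq_mul_div, one_mul, div_le_iff₀ hε0] at h3
      rw [systemBound] at h3
      linarith
    refine le_of_mul_le_mul_right (h1.trans ?_) hp0
    calc _ ≤ ε * p * (p : ℝ) ^ (n * d) := mul_le_mul_of_nonneg_right hW (by positivity)
      _ = _ := by ring
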